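/- Let $n\ge 2$, let $\Bbbk$ be a field and $q\in\Bbbk$, $q\neq 0$ (for instance $\Bbbk$ algebraically closed of characteristic different from $p$ and $q$ the image in $\Bbbk$ of the cardinality of the residue field of a finite extension of $\mathbb{Q}_p$). Let $\mathfrak{S}$ be the symmetric group on $n$ letters with simple reflections $\mathbb{I}=\{s_1,\dots,s_{n-1}\}$, let $\mathfrak{X}$ be the group of Laurent monomials in $X_1,\dots,X_n$, and let $W=\mathfrak{S}\ltimes\mathfrak{X}$ be the extended affine Weyl group of $\mathrm{GL}_n$, with $\sigma X_i\sigma^{-1}=X_{\sigma(i)}$. Put $\tau=s_{n-1}\cdots s_1X_1$ and $s_0=(1\,n)X_1X_n^{-1}$. The length $\ell(w)$ is the least $m$ such that $w=s_{i_1}\cdots s_{i_m}\tau^j$ with $i_1,\dots,i_m\in\{0,\dots,n-1\}$ and $j\in\mathbb{Z}$. Let $H$ be the Iwahori--Matsumoto Hecke algebra: the unital $\Bbbk$-algebra generated by $T_w$ $(w\in W)$ with relations $T_1=1$, $T_xT_y=T_{xy}$ if $\ell(xy)=\ell(x)+\ell(y)$, and $(T_{s_i}-q)(T_{s_i}+1)=0$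 for $0\le i\le n-1$. For $J\subseteq\mathbb{I}$ let $W_J=\langle J\rangle$ and $v_J=\sum_{w\in W_J}T_w$. Call $X_1^{a_1}\cdots X_n^{a_n}$ $J$-dominant if $a_i\ge a_j$ whenever $i\le j$ and $X_i$, $X_j$ are conjugate under $W_J$. For $K,J\subseteq\mathbb{I}$ let $D^{\mathbb{I}}_{K,J}\subseteq\mathfrak{S}$ be the set of shortest representatives of the double cosets in $W_K\backslash\mathfrak{S}/W_J$. For $w\in\mathfrak{S}$ write $K_1\cap w^{-1}K_2=\{t\in K_1\mid wtw^{-1}\in K_2\}$ and $wJ=\{t\in\mathbb{I}\mid w^{-1}tw\in J\}$. (1) For all $K,J\subseteq\mathbb{I}$ and $d\in W$ there is a (necessarily unique) homomorphism of right $H$-modules $b^d_{K,J}\colon v_JH\to v_KH$ with $b^d_{K,J}(v_J)=\sum_{u\in W_KdW_J}T_u$. (2) For all $K_1,K_2\subseteq\mathbb{I}$ the products $$b^1_{K_2,wJ}\;b^w_{wJ,J}\;b^p_{J,J}\;b^1_{J,K_1},\qquad w\in D^{\mathbb{I}}_{K_2,K_1},\quad J=K_1\cap w^{-1}K_2,\quad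 p\in\mathfrak{X}\ \text{$J$-dominant},$$ indexed by the pairs $(w,p)$, form a $\Bbbk$-basis of $\mathrm{Hom}_H(v_{K_1}H,v_{K_2}H)$. (3) Taken over all pairs $(K_1,K_2)$ and extended by zero to the other summands, these products form a $\Bbbk$-basis of the affine Schur algebra $\mathcal{S}=\mathrm{End}_H\bigl(\bigoplus_{J\subseteq\mathbb{I}}v_JH\bigr)$. -/

import Mathlib

/-!
Throughout, `n = r + 1`.  Permutations act on `Fin (r + 1)`, so that the index `i : Fin r` stands
for the simple reflection exchanging the neighbouring positions `i.castSucc` and `i.succ`.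
-/

namespace AffSchur

/-- The permutation action of the symmetric group on the group of Laurent monomials
`X^a = ∏ X_i ^ (a i)`, written by exponent vectors; `σ X_i σ⁻¹ = X_{σ i}`. -/
def permAction (r : ℕ) :
    Equiv.Perm (Fin (r + 1)) →* MulAut (Multiplicative (Fin (r + 1) → ℤ)) where
  toFun σ :=
    { toFun := fun a => Multiplicative.ofAdd (fun i => a.toAdd (σ⁻¹ i))
      invFun := fun a => Multiplicative.ofAdd (fun i => a.toAdd (σ i))
      left_inv := fun a => by
        apply Multiplicative.toAdd.injective
        funext i
        simp
      right_inv := fun a => by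
        apply Multiplicative.toAdd.injective
        funext i
        simp
      map_mul' := fun a b => rfl }
  map_one' := rfl
  map_mul' _ _ := by
    ext a : 1
    apply Multiplicative.toAdd.injective
    funext i
    simp

/-- The extended affine Weyl group of `GL_{r+1}`: the semidirect product of the symmetric group
with the lattice of Laurent monomials. -/
abbrev W (r : ℕ) : Type :=
  Multiplicative (Fin (r + 1) → ℤ) ⋊[permAction r] Equiv.Perm (Fin (r + 1))

/-- A permutation as an element of the extended affine Weyl group. -/
def perm {r : ℕ} (σ : Equiv.Perm (Fin (r + 1))) : W r := SemidirectProduct.inr σ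

/-- The monomial `X^a` as an element of the extended affine Weyl group. -/
def mono {r : ℕ} (a : Fin (r + 1) → ℤ) : W r := SemidirectProduct.inl (Multiplicative.ofAdd a)

/-- The variable `X_i`. -/
def var {r : ℕ} (i : Fin (r + 1)) : W r := mono (Pi.single i 1)

/-- The finite simple reflections `s_1, …, s_{n-1}`. -/
def s {r : ℕ} (i : Fin r) : W r := perm (Equiv.swap i.castSucc i.succ)

/-- The affine simple reflection `s_0 = (1 n) X_1 X_n⁻¹`. -/
def sZero (r : ℕ) : W r :=
  perm (Equiv.swap 0 (Fin.last r)) * var 0 * (var (Fin.last r))⁻¹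

/-- All simple reflections `s_0, s_1, …, s_{n-1}`. -/
def sAff {r : ℕ} (i : Fin (r + 1)) : W r := Fin.cases (sZero r) s i

/-- The element `τ = s_{n-1} ⋯ s_1 X_1`; the product `s_{n-1} ⋯ s_1` is the cycle `i ↦ i - 1`. -/
def tau (r : ℕ) : W r := perm (finRotate (r + 1))⁻¹ * var 0

/-- The length of `w`: the least number of simple reflections in an expression
`w = s_{i_1} ⋯ s_{i_m} τ ^ j`. -/
noncomputable def len {r : ℕ} (w : W r) : ℕ :=
  sInf {m | ∃ (l : List (Fin (r + 1))) (j : ℤ), l.length = m ∧ w = (l.map sAff).prod * tau r ^ j}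

/-- The parabolic subgroup generated by the reflections in `J`. -/
def parabolic {r : ℕ} (J : Finset (Fin r)) : Subgroup (W r) :=
  Subgroup.closure (s '' (J : Set (Fin r)))

/-- The double coset `W_K d W_J`. -/
def dcoset {r : ℕ} (K J : Finset (Fin r)) (d : W r) : Set (W r) :=
  {u | ∃ x ∈ parabolic K, ∃ y ∈ parabolic J, u = x * d * y}

theorem parabolic_finite {r : ℕ} (J : Finset (Fin r)) : (parabolic J : Set (W r)).Finite := by
  have h : parabolic J ≤ (SemidirectProduct.inr : Equiv.Perm (Fin (r + 1)) →* W r).range := by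
    rw [parabolic, Subgroup.closure_le]
    rintro _ ⟨i, -, rfl⟩
    exact ⟨_, rfl⟩
  exact (Set.finite_range (SemidirectProduct.inr : Equiv.Perm (Fin (r + 1)) →* W r)).subset h

theorem dcoset_finite {r : ℕ} (K J : Finset (Fin r)) (d : W r) : (dcoset K J d).Finite := by
  refine (((parabolic_finite K).prod (parabolic_finite J)).image
    (fun z => z.1 * d * z.2)).subset ?_
  rintro _ ⟨x, hx, y, hy, rfl⟩
  exact ⟨(x, y), ⟨hx, hy⟩, rfl⟩

/-- Shortest representatives in the symmetric group of the double cosets `W_K \ 𝔖 / W_J`. -/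
def shortest {r : ℕ} (K J : Finset (Fin r)) : Set (Equiv.Perm (Fin (r + 1))) :=
  {w | ∀ u ∈ dcoset K J (perm w), len (perm w) ≤ len u}

open Classical in
/-- `K₁ ∩ w⁻¹ K₂`: the reflections `t` in `K₁` with `w t w⁻¹` in `K₂`. -/
noncomputable def meet {r : ℕ} (K₁ K₂ : Finset (Fin r)) (w : Equiv.Perm (Fin (r + 1))) :
    Finset (Fin r) :=
  K₁.filter fun i => ∃ j ∈ K₂, perm w * s i * (perm w)⁻¹ = s j

open Classical in
/-- `w J`: the simple reflections of the form `w t w⁻¹` with `t` in `J`. -/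
noncomputable def conj {r : ℕ} (w : Equiv.Perm (Fin (r + 1))) (J : Finset (Fin r)) :
    Finset (Fin r) :=
  Finset.univ.filter fun j => ∃ i ∈ J, perm w * s i * (perm w)⁻¹ = s j

/-- `X^a` is `J`-dominant: `a i ≥ a j` whenever `i ≤ j` and `X_i`, `X_j` are conjugate
under `W_J`. -/
def Dominant {r : ℕ} (J : Finset (Fin r)) (a : Fin (r + 1) → ℤ) : Prop :=
  ∀ i j, i ≤ j → (∃ g ∈ parabolic J, g * var i * g⁻¹ = var j) → a j ≤ a i

section Hecke

variable {k : Type*} [Field k]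

/-- The Iwahori-Matsumoto relations between the generators `T_w`. -/
inductive HeckeRel (q : k) (r : ℕ) : FreeAlgebra k (W r) → FreeAlgebra k (W r) → Prop
  | one : HeckeRel q r (FreeAlgebra.ι k 1) 1
  | mul (x y : W r) (h : len (x * y) = len x + len y) :
      HeckeRel q r (FreeAlgebra.ι k x * FreeAlgebra.ι k y) (FreeAlgebra.ι k (x * y))
  | quad (i : Fin (r + 1)) :
      HeckeRel q r
        ((FreeAlgebra.ι k (sAff i) - algebraMap k _ q) * (FreeAlgebra.ι k (sAff i) + 1)) 0

/-- The Iwahori-Matsumoto Hecke algebra with parameter `q` of the extended affine Weyl group. -/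
def Hecke (q : k) (r : ℕ) : Type _ := RingQuot (HeckeRel q r)

noncomputable instance (q : k) (r : ℕ) : Ring (Hecke q r) :=
  inferInstanceAs (Ring (RingQuot (HeckeRel q r)))

noncomputable instance (q : k) (r : ℕ) : Algebra k (Hecke q r) :=
  inferInstanceAs (Algebra k (RingQuot (HeckeRel q r)))

/-- The element `T_w` of the Hecke algebra. -/
noncomputable def T (q : k) {r : ℕ} (w : W r) : Hecke q r :=
  RingQuot.mkAlgHom k (HeckeRel q r) (FreeAlgebra.ι k w)

/-- `v_J = ∑_{w ∈ W_J} T_w` (a finite sum). -/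
noncomputable def v (q : k) {r : ℕ} (J : Finset (Fin r)) : Hecke q r :=
  ∑ w ∈ (parabolic_finite J).toFinset, T q w

/-- The right ideal `v_J H`; right `H`-modules are modules over the opposite ring. -/
noncomputable def ideal (q : k) {r : ℕ} (J : Finset (Fin r)) :
    Submodule (Hecke q r)ᵐᵒᵖ (Hecke q r) :=
  Submodule.span _ {v q J}

/-- `v_J` as an element of `v_J H`. -/
noncomputable def gen (q : k) {r : ℕ} (J : Finset (Fin r)) : ideal q J :=
  ⟨v q J, Submodule.mem_span_singleton_self _⟩

/-- `Hom_H(v_J H, v_K H)`. -/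
abbrev HomH (q : k) {r : ℕ} (J K : Finset (Fin r)) : Type _ :=
  ideal q J →ₗ[(Hecke q r)ᵐᵒᵖ] ideal q K

/-- `∑_{u ∈ W_K d W_J} T_u` (a finite sum). -/
noncomputable def dsum (q : k) {r : ℕ} (K J : Finset (Fin r)) (d : W r) : Hecke q r :=
  ∑ u ∈ (dcoset_finite K J d).toFinset, T q u

/-- A homomorphism out of `v_J H` is determined by its value at `v_J`. -/
theorem hom_ext (q : k) {r : ℕ} {J K : Finset (Fin r)} {f g : HomH q J K}
    (h : f (gen q J) = g (gen q J)) : f = g := by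
  ext ⟨x, hx⟩
  obtain ⟨a, rfl⟩ := Submodule.mem_span_singleton.1 hx
  have e : (⟨a • v q J, hx⟩ : ideal q J) = a • gen q J := rfl
  rw [e, map_smul, map_smul, h]

open Classical in
/-- The homomorphism `b^d_{K,J} : v_J H → v_K H`, determined by
`b^d_{K,J} (v_J) = ∑_{u ∈ W_K d W_J} T_u`.  (That such a homomorphism always exists is part of
the theorem; the value `0` is never used.) -/
noncomputable def b (q : k) {r : ℕ} (K J : Finset (Fin r)) (d : W r) : HomH q J K :=
  if h : ∃ f : HomH q J K, (f (gen q J) : Hecke q r) = dsum q K J d then h.choose else 0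

/-- The labels `(w, p)` of the proposed basis of `Hom_H(v_{K₁} H, v_{K₂} H)`. -/
def Label {r : ℕ} (K₂ K₁ : Finset (Fin r)) : Type :=
  {x : Equiv.Perm (Fin (r + 1)) × (Fin (r + 1) → ℤ) //
    x.1 ∈ shortest K₂ K₁ ∧ Dominant (meet K₁ K₂ x.1) x.2}

/-- The product `b^1_{K₂,wJ} b^w_{wJ,J} b^p_{J,J} b^1_{J,K₁}` with `J = K₁ ∩ w⁻¹ K₂`. -/
noncomputable def basisElt (q : k) {r : ℕ} (K₂ K₁ : Finset (Fin r)) (x : Label K₂ K₁) :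
    HomH q K₁ K₂ :=
  let w := x.1.1
  let p := x.1.2
  let J := meet K₁ K₂ w
  b q K₂ (conj w J) 1 ∘ₗ b q (conj w J) J (perm w) ∘ₗ b q J J (mono p) ∘ₗ b q J K₁ 1

/-- The affine Schur algebra `End_H(⨁_J v_J H)`. -/
abbrev Schur (q : k) (r : ℕ) : Type _ :=
  Module.End (Hecke q r)ᵐᵒᵖ (DirectSum (Finset (Fin r)) fun J => ideal q J)

/-- A homomorphism `v_J H → v_K H` as an element of the affine Schur algebra, extended by zero
on the other summands. -/
noncomputable def toSchur (q : k) {r : ℕ} {J K : Finset (Fin r)} (f : HomH q J K) :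
    Schur q r :=
  DirectSum.lof (Hecke q r)ᵐᵒᵖ (Finset (Fin r)) (fun L => ideal q L) K ∘ₗ f ∘ₗ
    DirectSum.component (Hecke q r)ᵐᵒᵖ (Finset (Fin r)) (fun L => ideal q L) J

end Hecke

end AffSchur

/-!
`W` acts faithfully on `ℤ` by bijections commuting with translation by `n`, and the length of `w`
is its number of inversions modulo this translation. This gives the exchange behaviour of lengths,
and with it a representation of `H` on the free module with basis `W` which shows that the `T_w`
form a basis of `H`.

Evaluation at `v_J` identifies `Hom_H(v_J H, v_K H)` with the elements of `H` whose coefficients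
are constant on the double cosets `W_K \ W / W_J`, and these have the double coset sums as a basis.
The product with label `(w, p)` is a power of `q` times the sum over the double coset of `w X^p`,
plus a combination of sums over double cosets lying over strictly shorter elements of `𝔖`.
Every double coset contains `w X^p` for exactly one label `(w, p)`, so the passage from double
coset sums to products is triangular, with powers of `q` on the diagonal.
-/

namespace AffSchur

section AffineAction

variable {r : ℕ}

theorem exists_eq_coe_add (r : ℕ) (x : ℤ) :
    ∃ (i : Fin (r + 1)) (m : ℤ), x = (i : ℤ) + (r + 1 : ℤ) * m := by
  obtain ⟨⟨m, i⟩, rfl⟩ := (Int.divModEquiv (r + 1)).symm.surjective x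
  refine ⟨i, m, ?_⟩
  simp only [Int.divModEquiv_symm_apply, Nat.cast_add, Nat.cast_one]
  ring

theorem divModEquiv_coe_add (i : Fin (r + 1)) (m : ℤ) :
    Int.divModEquiv (r + 1) ((i : ℤ) + (r + 1 : ℤ) * m) = (m, i) := by
  rw [← Equiv.eq_symm_apply]
  simp only [Int.divModEquiv_symm_apply, Nat.cast_add, Nat.cast_one]
  ring

/-- The action of the extended affine Weyl group on `ℤ` by affine permutations, with `n = r + 1`:
`σ` permutes the residues `0, …, r` in each block of length `n`, and `X_i` lowers the integers
congruent to `i` by `n`. -/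
instance : SMul (W r) ℤ where
  smul w x :=
    let p := Int.divModEquiv (r + 1) x
    (w.right p.2 : ℤ) + (r + 1 : ℤ) * (p.1 - w.left.toAdd (w.right p.2))

theorem smul_coe_add (w : W r) (i : Fin (r + 1)) (m : ℤ) :
    w • ((i : ℤ) + (r + 1 : ℤ) * m) =
      (w.right i : ℤ) + (r + 1 : ℤ) * (m - w.left.toAdd (w.right i)) := by
  change _ + (r + 1 : ℤ) * _ = _
  rw [divModEquiv_coe_add]

instance : MulAction (W r) ℤ where
  one_smul x := by
    obtain ⟨i, m, rfl⟩ := exists_eq_coe_add r x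
    simp [smul_coe_add]
  mul_smul u w x := by
    obtain ⟨i, m, rfl⟩ := exists_eq_coe_add r x
    have hleft : (u * w).left.toAdd (u.right (w.right i)) =
        u.left.toAdd (u.right (w.right i)) + w.left.toAdd (w.right i) := by simp [permAction]
    rw [smul_coe_add, smul_coe_add, smul_coe_add, SemidirectProduct.mul_right,
      Equiv.Perm.mul_apply, hleft]
    ring

theorem smul_coe (w : W r) (i : Fin (r + 1)) :
    w • (i : ℤ) = (w.right i : ℤ) - (r + 1 : ℤ) * w.left.toAdd (w.right i) := by
  simpa [sub_eq_add_neg] using smul_coe_add w i 0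

theorem smul_add_period_mul (w : W r) (x m : ℤ) :
    w • (x + (r + 1 : ℤ) * m) = w • x + (r + 1 : ℤ) * m := by
  obtain ⟨i, l, rfl⟩ := exists_eq_coe_add r x
  rw [add_assoc, ← mul_add, smul_coe_add, smul_coe_add]
  ring

theorem period_dvd_iff {x : ℤ} (h₁ : -(r + 1 : ℤ) < x) (h₂ : x < r + 1) :
    (r + 1 : ℤ) ∣ x ↔ x = 0 :=
  ⟨fun h => Int.eq_zero_of_abs_lt_dvd h (abs_lt.2 ⟨h₁, h₂⟩), fun h => h ▸ dvd_zero _⟩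

theorem coe_add_inj {i j : Fin (r + 1)} {m l : ℤ} :
    (i : ℤ) + (r + 1 : ℤ) * m = (j : ℤ) + (r + 1 : ℤ) * l ↔ i = j ∧ m = l := by
  refine ⟨fun h => ?_, by rintro ⟨rfl, rfl⟩; rfl⟩
  have hij : (i : ℤ) - j = 0 :=
    (period_dvd_iff (r := r) (by omega) (by omega)).1 ⟨l - m, by linear_combination h⟩
  obtain rfl : i = j := Fin.ext (by omega)
  exact ⟨rfl, mul_left_cancel₀ (by positivity) (add_left_cancel h)⟩

instance : FaithfulSMul (W r) ℤ where
  eq_of_smul_eq_smul {u w} h := by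
    have key (i : Fin (r + 1)) := coe_add_inj.1 ((smul_coe_add u i 0).symm.trans
      ((h _).trans (smul_coe_add w i 0)))
    have hright : u.right = w.right := Equiv.ext fun i => (key i).1
    refine SemidirectProduct.ext (Multiplicative.toAdd.injective (funext fun i => ?_)) hright
    simpa [← hright] using (key (u.right⁻¹ i)).2

theorem period_dvd_smul_sub_smul_iff (w : W r) {x y : ℤ} :
    (r + 1 : ℤ) ∣ w • x - w • y ↔ (r + 1 : ℤ) ∣ x - y := by
  have smul_dvd (u : W r) {x y : ℤ} (h : (r + 1 : ℤ) ∣ x - y) : (r + 1 : ℤ) ∣ u • x - u • y := by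
    obtain ⟨m, hm⟩ := h
    exact ⟨m, by rw [eq_add_of_sub_eq' hm, smul_add_period_mul, add_sub_cancel_left]⟩
  exact ⟨fun h => by simpa using smul_dvd w⁻¹ h, smul_dvd w⟩

theorem perm_smul_coe_add (σ : Equiv.Perm (Fin (r + 1))) (i : Fin (r + 1)) (m : ℤ) :
    perm σ • ((i : ℤ) + (r + 1 : ℤ) * m) = (σ i : ℤ) + (r + 1 : ℤ) * m := by
  simp [smul_coe_add, perm]

theorem perm_smul_coe (σ : Equiv.Perm (Fin (r + 1))) (i : Fin (r + 1)) :
    perm σ • (i : ℤ) = (σ i : ℤ) := by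
  simpa using perm_smul_coe_add σ i 0

theorem mono_smul_coe (a : Fin (r + 1) → ℤ) (i : Fin (r + 1)) :
    mono a • (i : ℤ) = (i : ℤ) + (r + 1 : ℤ) * -a i := by
  simp [smul_coe, mono, sub_eq_add_neg]

theorem tau_smul (x : ℤ) : tau r • x = x - 1 := by
  suffices h : ∀ i : Fin (r + 1), tau r • (i : ℤ) = i - 1 by
    obtain ⟨i, m, rfl⟩ := exists_eq_coe_add r x
    rw [smul_add_period_mul, h, add_sub_right_comm]
  intro i
  rw [tau, var, mul_smul, mono_smul_coe, perm_smul_coe_add]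
  cases i using Fin.cases with
  | zero =>
    have h : (finRotate (r + 1))⁻¹ 0 = Fin.last r := by
      rw [Equiv.Perm.inv_eq_iff_eq]; simp
    simp [h]
  | succ i =>
    have h : (finRotate (r + 1))⁻¹ i.succ = i.castSucc := by
      rw [Equiv.Perm.inv_eq_iff_eq]; simp
    simp [h]

theorem tau_zpow_smul (m x : ℤ) : tau r ^ m • x = x - m := by
  induction m using Int.induction_on generalizing x with
  | zero => simp
  | succ k ih => rw [zpow_add_one, mul_smul, tau_smul, ih]; ring
  | pred k ih =>
    have hinv : (tau r)⁻¹ • x = x + 1 := by rw [inv_smul_eq_iff, tau_smul, add_sub_cancel_right]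
    rw [zpow_sub_one, mul_smul, hinv, ih]
    ring

theorem sAff_zero : sAff (0 : Fin (r + 1)) = sZero r := rfl

theorem sAff_succ (i : Fin r) : sAff i.succ = s i := rfl

theorem sZero_eq (r : ℕ) : sZero r = perm (Equiv.swap 0 (Fin.last r)) *
    mono (Pi.single 0 1 - Pi.single (Fin.last r) 1) := by
  rw [sZero, mul_assoc, var, var, mono, mono, mono, ofAdd_sub, div_eq_mul_inv, map_mul, map_inv]

theorem sAff_smul_of_not_dvd {j : Fin (r + 1)} {x : ℤ} (h₁ : ¬ (r + 1 : ℤ) ∣ x - j)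
    (h₂ : ¬ (r + 1 : ℤ) ∣ x - (j - 1)) : sAff j • x = x := by
  obtain ⟨k, m, rfl⟩ := exists_eq_coe_add r x
  have hkj : k ≠ j := by rintro rfl; simp at h₁
  rw [smul_add_period_mul, add_left_inj]
  cases j using Fin.cases with
  | zero =>
    have hkl : k ≠ Fin.last r := by
      rintro rfl
      exact h₂ ⟨m + 1, by simp only [Fin.val_last, Fin.val_zero, Nat.cast_zero]; ring⟩
    rw [sAff_zero, sZero_eq, mul_smul, mono_smul_coe, perm_smul_coe_add,
      Equiv.swap_apply_of_ne_of_ne hkj hkl]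
    simp [hkj, hkl]
  | succ i =>
    have hki : k ≠ i.castSucc := by rintro rfl; simp at h₂
    rw [sAff_succ, s, perm_smul_coe, Equiv.swap_apply_of_ne_of_ne hki hkj]

variable [NeZero r]

theorem zero_ne_last : (0 : Fin (r + 1)) ≠ Fin.last r :=
  (Fin.last_pos' (n := r)).ne

theorem sAff_smul_self (j : Fin (r + 1)) : sAff j • (j : ℤ) = j - 1 := by
  cases j using Fin.cases with
  | zero =>
    rw [sAff_zero, sZero_eq, mul_smul, mono_smul_coe, perm_smul_coe_add]
    simp [Pi.single_eq_of_ne zero_ne_last]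
  | succ i => rw [sAff_succ, s, perm_smul_coe]; simp

theorem sAff_smul_sub_one (j : Fin (r + 1)) : sAff j • (j - 1 : ℤ) = j := by
  cases j using Fin.cases with
  | zero =>
    have h : ((0 : Fin (r + 1)) - 1 : ℤ) = (Fin.last r : ℤ) + (r + 1 : ℤ) * (-1) := by simp
    rw [h, smul_add_period_mul, sAff_zero, sZero_eq, mul_smul, mono_smul_coe, perm_smul_coe_add]
    simp [zero_ne_last.symm]
  | succ i =>
    have h : (i.succ - 1 : ℤ) = (i.castSucc : ℤ) := by simp
    rw [h, sAff_succ, s, perm_smul_coe]; simp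

theorem sAff_smul_cases (j : Fin (r + 1)) (x : ℤ) :
    (∃ m, x = j + (r + 1 : ℤ) * m ∧ sAff j • x = x - 1) ∨
    (∃ m, x = (j - 1) + (r + 1 : ℤ) * m ∧ sAff j • x = x + 1) ∨
    (¬ (r + 1 : ℤ) ∣ x - j ∧ ¬ (r + 1 : ℤ) ∣ x - (j - 1) ∧ sAff j • x = x) := by
  by_cases h₁ : (r + 1 : ℤ) ∣ x - j
  · obtain ⟨m, hm⟩ := h₁
    obtain rfl := eq_add_of_sub_eq' hm
    exact Or.inl ⟨m, rfl, by rw [smul_add_period_mul, sAff_smul_self]; ring⟩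
  by_cases h₂ : (r + 1 : ℤ) ∣ x - (j - 1)
  · obtain ⟨m, hm⟩ := h₂
    obtain rfl := eq_add_of_sub_eq' hm
    exact Or.inr (Or.inl ⟨m, rfl, by rw [smul_add_period_mul, sAff_smul_sub_one]; ring⟩)
  · exact Or.inr (Or.inr ⟨h₁, h₂, sAff_smul_of_not_dvd h₁ h₂⟩)

theorem exists_of_sAff_smul_lt {j : Fin (r + 1)} {x y : ℤ} (hxy : x < y)
    (h : sAff j • y < sAff j • x) :
    ∃ m, x = (j - 1) + (r + 1 : ℤ) * m ∧ y = j + (r + 1 : ℤ) * m := by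
  -- `s_j` moves every integer by at most one, so `x` moves up, `y` moves down, and `y = x + 1`.
  rcases sAff_smul_cases j x with ⟨l, hx, ex⟩ | ⟨l, hx, ex⟩ | ⟨-, -, ex⟩ <;>
  rcases sAff_smul_cases j y with ⟨m, hy, ey⟩ | ⟨m, hy, ey⟩ | ⟨-, -, ey⟩ <;>
  first
  | omega
  | exact ⟨m, by omega, hy⟩

theorem sAff_mul_eq_mul_sAff {w : W r} {i j : Fin (r + 1)} {m : ℤ}
    (hpred : w • (j - 1 : ℤ) = (i - 1) + (r + 1 : ℤ) * m)
    (hself : w • (j : ℤ) = i + (r + 1 : ℤ) * m) :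
    sAff i * w = w * sAff j := by
  refine FaithfulSMul.eq_of_smul_eq_smul fun x : ℤ => ?_
  rw [mul_smul, mul_smul]
  rcases sAff_smul_cases j x with ⟨l, rfl, -⟩ | ⟨l, rfl, -⟩ | ⟨h₁, h₂, hx⟩
  · simp only [smul_add_period_mul, sAff_smul_self, hself, hpred]
  · simp only [smul_add_period_mul, sAff_smul_sub_one, hself, hpred]
  · rw [hx]
    rw [← period_dvd_smul_sub_smul_iff w] at h₁ h₂
    refine sAff_smul_of_not_dvd (fun h => h₁ ?_) (fun h => h₂ ?_)
    · rw [hself, ← sub_sub]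
      exact dvd_sub h (dvd_mul_right _ _)
    · rw [hpred, ← sub_sub]
      exact dvd_sub h (dvd_mul_right _ _)

@[simp]
theorem sAff_mul_self (j : Fin (r + 1)) : sAff j * sAff j = 1 := by
  refine FaithfulSMul.eq_of_smul_eq_smul fun x : ℤ => ?_
  rw [mul_smul, one_smul]
  rcases sAff_smul_cases j x with ⟨m, rfl, -⟩ | ⟨m, rfl, -⟩ | ⟨-, -, hx⟩
  · simp only [smul_add_period_mul, sAff_smul_self, sAff_smul_sub_one]
  · simp only [smul_add_period_mul, sAff_smul_self, sAff_smul_sub_one]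
  · rw [hx, hx]

@[simp]
theorem sAff_inv (j : Fin (r + 1)) : (sAff j)⁻¹ = sAff j :=
  inv_eq_of_mul_eq_one_left (sAff_mul_self j)

@[simp]
theorem sAff_mul_cancel_left (j : Fin (r + 1)) (w : W r) : sAff j * (sAff j * w) = w := by
  rw [← mul_assoc, sAff_mul_self, one_mul]

@[simp]
theorem sAff_mul_cancel_right (j : Fin (r + 1)) (w : W r) : w * sAff j * sAff j = w := by
  rw [mul_assoc, sAff_mul_self, mul_one]

theorem exists_sAff_mul_tau_zpow (m : ℤ) (j : Fin (r + 1)) :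
    ∃ i : Fin (r + 1), sAff i * tau r ^ m = tau r ^ m * sAff j := by
  obtain ⟨i, l, hi⟩ := exists_eq_coe_add r (j - m)
  refine ⟨i, sAff_mul_eq_mul_sAff (m := l) ?_ ?_⟩ <;> rw [tau_zpow_smul] <;> omega

theorem exists_tau_zpow_mul_sAff (m : ℤ) (j : Fin (r + 1)) :
    ∃ i : Fin (r + 1), tau r ^ m * sAff i = sAff j * tau r ^ m := by
  obtain ⟨i, hi⟩ := exists_sAff_mul_tau_zpow (-m) j
  exact ⟨i, by simpa [mul_assoc] using congrArg (tau r ^ m * · * tau r ^ m) hi⟩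

end AffineAction

section Length

variable {r : ℕ}

theorem natAbs_neg_ediv_of_pos {d n : ℤ} (hn : 0 < n) (hd : 0 < d) (h : ¬ n ∣ d) :
    (-d / n).natAbs = (d / n).natAbs + 1 := by
  have := Int.ediv_nonneg hd.le hn.le
  rw [Int.neg_ediv, if_neg h, Int.sign_eq_one_of_pos hn]
  omega

theorem natAbs_neg_add_ediv {d n : ℤ} (hn : 0 < n) (h : ¬ n ∣ d) :
    ((-d + n) / n).natAbs = (d / n).natAbs := by
  rw [Int.add_ediv_of_dvd_right (dvd_refl n), Int.ediv_self hn.ne', Int.neg_ediv, if_neg h,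
    Int.sign_eq_one_of_pos hn, sub_add_cancel, Int.natAbs_neg]

/-- The number of inversions of `w` among the pairs of integers congruent to `x` and `y`. -/
def crossings (w : W r) (x y : ℤ) : ℕ := ((w • y - w • x) / (r + 1 : ℤ)).natAbs

theorem crossings_mul (u w : W r) (x y : ℤ) :
    crossings (u * w) x y = crossings u (w • x) (w • y) := by
  simp only [crossings, mul_smul]

theorem crossings_swap_of_lt {w : W r} {x y : ℤ} (h : ¬ (r + 1 : ℤ) ∣ y - x)
    (hw : w • x < w • y) : crossings w y x = crossings w x y + 1 := by
  rw [← period_dvd_smul_sub_smul_iff w] at h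
  rw [crossings, crossings, ← natAbs_neg_ediv_of_pos (by positivity) (by omega) h, neg_sub]

theorem crossings_sub_period {w : W r} {x y : ℤ} (h : ¬ (r + 1 : ℤ) ∣ y - x) :
    crossings w (y - (r + 1)) x = crossings w x y := by
  rw [← period_dvd_smul_sub_smul_iff w] at h
  have hshift : w • (y - (r + 1)) = w • y - (r + 1) := by
    simpa [sub_eq_add_neg] using smul_add_period_mul w y (-1)
  rw [crossings, crossings, hshift, ← natAbs_neg_add_ediv (by positivity) h]
  ring_nf

/-- The number of inversions of an affine permutation, by Shi's formula. -/
def inversions (w : W r) : ℕ :=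
  ∑ i : Fin (r + 1), ∑ j : Fin (r + 1), if i < j then crossings w i j else 0

theorem inversions_one : inversions (1 : W r) = 0 := by
  refine Finset.sum_eq_zero fun i _ => Finset.sum_eq_zero fun j _ => ?_
  split_ifs with h
  · rw [crossings, one_smul, one_smul, Int.ediv_eq_zero_of_lt (by omega) (by omega),
      Int.natAbs_zero]
  · rfl

theorem swap_lt_swap_iff {i : Fin r} {a b : Fin (r + 1)} (h : (a, b) ≠ (i.castSucc, i.succ))
    (h' : (a, b) ≠ (i.succ, i.castSucc)) :
    Equiv.swap i.castSucc i.succ a < Equiv.swap i.castSucc i.succ b ↔ a < b := by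
  simp only [ne_eq, Prod.mk.injEq, Fin.ext_iff, Fin.val_succ, Fin.val_castSucc] at h h'
  simp only [Equiv.swap_apply_def, Fin.ext_iff, Fin.lt_def, Fin.val_succ, Fin.val_castSucc]
  split_ifs <;> simp only [Fin.val_succ, Fin.val_castSucc] at * <;> omega

theorem sum_lt_swap_add {M : Type*} [AddCommMonoid M] (i : Fin r)
    (g : Fin (r + 1) → Fin (r + 1) → M) :
    (∑ a, ∑ b, if a < b then
        g (Equiv.swap i.castSucc i.succ a) (Equiv.swap i.castSucc i.succ b) else 0) +
      g i.castSucc i.succ =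
    (∑ a, ∑ b, if a < b then g a b else 0) + g i.succ i.castSucc := by
  set σ := Equiv.swap i.castSucc i.succ with hσ
  have hreindex : (∑ a, ∑ b, if a < b then g (σ a) (σ b) else 0) =
      ∑ a, ∑ b, if σ a < σ b then g a b else 0 := by
    rw [← Equiv.sum_comp σ]
    refine Finset.sum_congr rfl fun a _ => ?_
    rw [← Equiv.sum_comp σ]
    simp [hσ]
  have hpoint (p : Fin (r + 1) × Fin (r + 1)) :
      (if σ p.1 < σ p.2 then g p.1 p.2 else 0) +
        (if p = (i.castSucc, i.succ) then g p.1 p.2 else 0) =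
      (if p.1 < p.2 then g p.1 p.2 else 0) +
        if p = (i.succ, i.castSucc) then g p.1 p.2 else 0 := by
    by_cases h : p = (i.castSucc, i.succ)
    · simp [h, hσ, (Fin.castSucc_lt_succ).ne, (Fin.castSucc_lt_succ).not_gt]
    by_cases h' : p = (i.succ, i.castSucc)
    · simp [h', hσ, (Fin.castSucc_lt_succ).ne', (Fin.castSucc_lt_succ).not_gt]
    · simp [h, h', hσ, swap_lt_swap_iff h h']
  have hsum := Finset.sum_congr (rfl : Finset.univ = Finset.univ) fun p _ => hpoint p
  simp only [Finset.sum_add_distrib, Finset.sum_ite_eq', Finset.mem_univ, if_true] at hsum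
  simpa only [hreindex, Fintype.sum_prod_type] using hsum

theorem inversions_mul_s_of_lt {w : W r} {i : Fin r} (h : w • (i : ℤ) < w • (i + 1 : ℤ)) :
    inversions (w * s i) = inversions w + 1 := by
  have hdvd : ¬ (r + 1 : ℤ) ∣ (i + 1 : ℤ) - i := by
    rw [period_dvd_iff (by omega) (by omega)]
    omega
  have hcross := crossings_swap_of_lt hdvd h
  have hswap := sum_lt_swap_add i fun a b => crossings w a b
  simp only [Fin.val_castSucc, Fin.val_succ, Nat.cast_add, Nat.cast_one, hcross] at hswap
  simp only [inversions, crossings_mul, s, perm_smul_coe]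
  omega

theorem sum_lt_eq_sum_zero_add {M : Type*} [AddCommMonoid M] (g : Fin (r + 1) → Fin (r + 1) → M) :
    (∑ a, ∑ b, if a < b then g a b else 0) =
      ∑ j : Fin r, g 0 j.succ + ∑ a : Fin r, ∑ b : Fin r, if a < b then g a.succ b.succ else 0 := by
  simp [Fin.sum_univ_succ]

theorem sum_lt_eq_sum_last_add {M : Type*} [AddCommMonoid M] (g : Fin (r + 1) → Fin (r + 1) → M) :
    (∑ a, ∑ b, if a < b then g a b else 0) =
      ∑ i : Fin r, g i.castSucc (Fin.last r) +
        ∑ a : Fin r, ∑ b : Fin r, if a < b then g a.castSucc b.castSucc else 0 := by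
  simp [Fin.sum_univ_castSucc, Finset.sum_add_distrib, add_comm, (Fin.le_last _).not_gt]

theorem inversions_mul_tau (w : W r) : inversions (w * tau r) = inversions w := by
  simp only [inversions, crossings_mul, tau_smul]
  rw [sum_lt_eq_sum_zero_add, sum_lt_eq_sum_last_add]
  congr 1
  · refine Finset.sum_congr rfl fun i _ => ?_
    have hdvd : ¬ (r + 1 : ℤ) ∣ (r : ℤ) - i := by
      rw [period_dvd_iff (by omega) (by omega)]
      omega
    simpa using crossings_sub_period (w := w) hdvd
  · simp

theorem inversions_mul_tau_zpow (w : W r) (m : ℤ) : inversions (w * tau r ^ m) = inversions w := by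
  induction m using Int.induction_on with
  | zero => rw [zpow_zero, mul_one]
  | succ k ih => rw [zpow_add_one, ← mul_assoc, inversions_mul_tau, ih]
  | pred k ih => rw [← ih, ← inversions_mul_tau, mul_assoc, ← zpow_add_one, sub_add_cancel]

theorem exists_tau_zpow_of_forall_lt {w : W r}
    (h : ∀ j : Fin (r + 1), w • (j - 1 : ℤ) < w • (j : ℤ)) : ∃ m : ℤ, w = tau r ^ m := by
  have hpred (x : ℤ) : w • (x - 1) < w • x := by
    obtain ⟨i, m, rfl⟩ := exists_eq_coe_add r x
    rw [add_sub_right_comm, smul_add_period_mul, smul_add_period_mul]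
    have := h i
    omega
  have hmono : StrictMono (w • · : ℤ → ℤ) :=
    strictMono_int_of_lt_succ fun x => by simpa using hpred (x + 1)
  -- A strictly increasing bijection of `ℤ` is a translation.
  have hstep (x : ℤ) : w • (x - 1) = w • x - 1 := by
    set z := w⁻¹ • (w • x - 1)
    have hwz : w • z = w • x - 1 := smul_inv_smul w _
    have hzx : z < x := hmono.lt_iff_lt.1 (by simp only [hwz]; omega)
    have hle : w • z ≤ w • (x - 1) := hmono.monotone (by omega)
    have := hpred x
    omega
  have htranslate (x : ℤ) : w • x = w • (0 : ℤ) + x := by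
    induction x using Int.induction_on with
    | zero => ring
    | succ k ih =>
      have := hstep (k + 1)
      rw [add_sub_cancel_right] at this
      omega
    | pred k ih => rw [hstep]; omega
  refine ⟨-(w • (0 : ℤ)), FaithfulSMul.eq_of_smul_eq_smul fun x : ℤ => ?_⟩
  rw [htranslate, tau_zpow_smul]
  ring

theorem len_word_le (l : List (Fin (r + 1))) (j : ℤ) :
    len ((l.map sAff).prod * tau r ^ j) ≤ l.length :=
  Nat.sInf_le ⟨l, j, rfl, rfl⟩

theorem len_one : len (1 : W r) = 0 := by
  simpa using len_word_le (r := r) [] 0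

variable [NeZero r]

theorem inversions_mul_sAff_of_lt {w : W r} {j : Fin (r + 1)}
    (h : w • (j - 1 : ℤ) < w • (j : ℤ)) : inversions (w * sAff j) = inversions w + 1 := by
  cases j using Fin.cases with
  | zero =>
    have hconj : tau r * s 0 = sZero r * tau r := by
      refine (sAff_mul_eq_mul_sAff (w := tau r) (i := 0) (j := Fin.succ 0) (m := 0) ?_ ?_).symm <;>
        simp only [tau_smul, Fin.val_succ, Fin.val_zero] <;> simp
    have hlt : (w * tau r) • ((0 : Fin r) : ℤ) < (w * tau r) • ((0 : Fin r) + 1 : ℤ) := by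
      simpa [mul_smul, tau_smul] using h
    rw [sAff_zero, ← inversions_mul_tau, mul_assoc, ← hconj, ← mul_assoc,
      inversions_mul_s_of_lt hlt, inversions_mul_tau]
  | succ i => exact inversions_mul_s_of_lt (by simpa using h)

theorem inversions_mul_sAff_of_not_lt {w : W r} {j : Fin (r + 1)}
    (h : ¬ w • (j - 1 : ℤ) < w • (j : ℤ)) : inversions (w * sAff j) + 1 = inversions w := by
  have hne : w • (j - 1 : ℤ) ≠ w • (j : ℤ) := by simp
  rw [← inversions_mul_sAff_of_lt (w := w * sAff j) (j := j), sAff_mul_cancel_right]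
  rw [mul_smul, mul_smul, sAff_smul_self, sAff_smul_sub_one]
  omega

theorem exists_word_length_eq_inversions (w : W r) :
    ∃ (l : List (Fin (r + 1))) (j : ℤ),
      l.length = inversions w ∧ w = (l.map sAff).prod * tau r ^ j := by
  induction hN : inversions w generalizing w with
  | zero =>
    obtain ⟨m, hm⟩ := exists_tau_zpow_of_forall_lt (w := w) fun j => by
      by_contra h
      have := inversions_mul_sAff_of_not_lt h
      omega
    exact ⟨[], m, rfl, by simpa using hm⟩
  | succ N ih =>
    obtain ⟨j, hj⟩ : ∃ j : Fin (r + 1), ¬ w • (j - 1 : ℤ) < w • (j : ℤ) := by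
      by_contra! h
      obtain ⟨m, rfl⟩ := exists_tau_zpow_of_forall_lt h
      rw [← one_mul (tau r ^ m), inversions_mul_tau_zpow, inversions_one] at hN
      omega
    have hlen := inversions_mul_sAff_of_not_lt hj
    obtain ⟨l, m, hl, hw⟩ := ih (w * sAff j) (by omega)
    obtain ⟨i, hi⟩ := exists_sAff_mul_tau_zpow m j
    refine ⟨l ++ [i], m, by simp [hl], ?_⟩
    rw [List.map_append, List.prod_append, List.map_singleton, List.prod_singleton, mul_assoc, hi,
      ← mul_assoc, ← hw, sAff_mul_cancel_right]

theorem inversions_word_le (l : List (Fin (r + 1))) (j : ℤ) :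
    inversions ((l.map sAff).prod * tau r ^ j) ≤ l.length := by
  rw [inversions_mul_tau_zpow]
  induction l using List.reverseRecOn with
  | nil => simp [inversions_one]
  | append_singleton l a ih =>
    rw [List.map_append, List.prod_append, List.map_singleton, List.prod_singleton,
      List.length_append, List.length_singleton]
    by_cases h : (l.map sAff).prod • (a - 1 : ℤ) < (l.map sAff).prod • (a : ℤ)
    · have := inversions_mul_sAff_of_lt h; omega
    · have := inversions_mul_sAff_of_not_lt h; omega

theorem len_eq_inversions (w : W r) : len w = inversions w := by
  obtain ⟨l, j, hl, hw⟩ := exists_word_length_eq_inversions w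
  refine le_antisymm (Nat.sInf_le ⟨l, j, hl, hw⟩) (le_csInf ⟨_, l, j, hl, hw⟩ ?_)
  rintro m ⟨l, j, rfl, rfl⟩
  exact inversions_word_le l j

theorem exists_reduced_word (w : W r) :
    ∃ (l : List (Fin (r + 1))) (j : ℤ), l.length = len w ∧ w = (l.map sAff).prod * tau r ^ j := by
  rw [len_eq_inversions]
  exact exists_word_length_eq_inversions w

theorem len_mul_tau_zpow (w : W r) (m : ℤ) : len (w * tau r ^ m) = len w := by
  rw [len_eq_inversions, len_eq_inversions, inversions_mul_tau_zpow]

theorem len_mul_sAff_of_lt {w : W r} {j : Fin (r + 1)} (h : w • (j - 1 : ℤ) < w • (j : ℤ)) :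
    len (w * sAff j) = len w + 1 := by
  rw [len_eq_inversions, len_eq_inversions, inversions_mul_sAff_of_lt h]

theorem len_mul_sAff_of_not_lt {w : W r} {j : Fin (r + 1)} (h : ¬ w • (j - 1 : ℤ) < w • (j : ℤ)) :
    len (w * sAff j) + 1 = len w := by
  rw [len_eq_inversions, len_eq_inversions, inversions_mul_sAff_of_not_lt h]

theorem len_lt_mul_sAff_iff {w : W r} {j : Fin (r + 1)} :
    len w < len (w * sAff j) ↔ w • (j - 1 : ℤ) < w • (j : ℤ) := by
  refine ⟨fun h => ?_, fun h => by rw [len_mul_sAff_of_lt h]; omega⟩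
  by_contra hlt
  have := len_mul_sAff_of_not_lt hlt
  omega

theorem len_mul_sAff (w : W r) (j : Fin (r + 1)) :
    len (w * sAff j) = len w + 1 ∨ len (w * sAff j) + 1 = len w := by
  by_cases h : w • (j - 1 : ℤ) < w • (j : ℤ)
  · exact Or.inl (len_mul_sAff_of_lt h)
  · exact Or.inr (len_mul_sAff_of_not_lt h)

theorem exists_word_inv (l : List (Fin (r + 1))) (m : ℤ) :
    ∃ l' : List (Fin (r + 1)), l'.length = l.length ∧
      ((l.map sAff).prod * tau r ^ m)⁻¹ = (l'.map sAff).prod * tau r ^ (-m) := by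
  induction l using List.reverseRecOn with
  | nil => exact ⟨[], rfl, by simp⟩
  | append_singleton l a ih =>
    obtain ⟨l', hlen, hinv⟩ := ih
    obtain ⟨i, hi⟩ := exists_tau_zpow_mul_sAff m a
    refine ⟨i :: l', by simp [hlen], ?_⟩
    rw [List.map_append, List.prod_append, List.map_singleton, List.prod_singleton, mul_assoc,
      ← hi, ← mul_assoc, mul_inv_rev, hinv, sAff_inv, List.map_cons, List.prod_cons, mul_assoc]

@[simp]
theorem len_inv (w : W r) : len w⁻¹ = len w := by
  have len_inv_le (u : W r) : len u⁻¹ ≤ len u := by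
    obtain ⟨l, m, hlen, hu⟩ := exists_reduced_word u
    obtain ⟨l', hlen', hinv⟩ := exists_word_inv l m
    rw [← hlen, ← hlen', hu, hinv]
    exact len_word_le _ _
  exact (len_inv_le w).antisymm (by simpa using len_inv_le w⁻¹)

theorem len_tau_zpow_mul (w : W r) (m : ℤ) : len (tau r ^ m * w) = len w := by
  rw [← len_inv, mul_inv_rev, ← zpow_neg, len_mul_tau_zpow, len_inv]

theorem len_tau_zpow (m : ℤ) : len (tau r ^ m) = 0 := by
  rw [← one_mul (tau r ^ m), len_mul_tau_zpow, len_one]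

theorem len_sAff_mul_eq (w : W r) (j : Fin (r + 1)) : len (sAff j * w) = len (w⁻¹ * sAff j) := by
  rw [← len_inv, mul_inv_rev, sAff_inv]

theorem len_sAff_mul (w : W r) (j : Fin (r + 1)) :
    len (sAff j * w) = len w + 1 ∨ len (sAff j * w) + 1 = len w := by
  rw [len_sAff_mul_eq, ← len_inv w]
  exact len_mul_sAff w⁻¹ j

theorem len_lt_sAff_mul_iff {w : W r} {j : Fin (r + 1)} :
    len w < len (sAff j * w) ↔ w⁻¹ • (j - 1 : ℤ) < w⁻¹ • (j : ℤ) := by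
  rw [len_sAff_mul_eq, ← len_inv w, len_lt_mul_sAff_iff]

theorem len_sAff (j : Fin (r + 1)) : len (sAff j) = 1 := by
  have h := len_mul_sAff 1 j
  rw [one_mul, len_one] at h
  omega

theorem len_mul_le (u w : W r) : len (u * w) ≤ len u + len w := by
  obtain ⟨l, m, hlen, hu⟩ := exists_reduced_word u
  rw [← hlen, hu]
  clear hlen hu
  induction l with
  | nil => simp [len_tau_zpow_mul]
  | cons a l ih =>
    rw [List.map_cons, List.prod_cons, mul_assoc, mul_assoc, List.length_cons]
    rw [mul_assoc] at ih
    have := len_sAff_mul ((l.map sAff).prod * (tau r ^ m * w)) a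
    omega

theorem sAff_mul_eq_of_len_lt {w : W r} {i j : Fin (r + 1)} (hi : len w < len (sAff i * w))
    (hij : len (sAff i * (w * sAff j)) < len (w * sAff j)) : sAff i * w = w * sAff j := by
  have hlt : w⁻¹ • (i - 1 : ℤ) < w⁻¹ • (i : ℤ) := len_lt_sAff_mul_iff.1 hi
  have hle := (not_congr len_lt_sAff_mul_iff).1 hij.not_gt
  rw [mul_inv_rev, sAff_inv, mul_smul, mul_smul, not_lt] at hle
  -- `s_j` reverses the order of `w⁻¹ (i - 1)` and `w⁻¹ i`, so these are translates of `j - 1`, `j`.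
  obtain ⟨m, hpred, hself⟩ := exists_of_sAff_smul_lt hlt (hle.lt_of_ne (by simp; omega))
  rw [inv_smul_eq_iff, smul_add_period_mul] at hpred hself
  exact sAff_mul_eq_mul_sAff (m := -m) (by linarith) (by linarith)

theorem exists_right_descent {w : W r} (h : len w ≠ 0) : ∃ j, len (w * sAff j) + 1 = len w := by
  by_contra! hasc
  obtain ⟨m, rfl⟩ := exists_tau_zpow_of_forall_lt (w := w) fun j =>
    len_lt_mul_sAff_iff.1 (by have := (len_mul_sAff w j).resolve_right (hasc j); omega)
  exact h (len_tau_zpow m)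

theorem exists_left_descent {w : W r} (h : len w ≠ 0) : ∃ j, len (sAff j * w) + 1 = len w := by
  simpa [len_sAff_mul_eq] using exists_right_descent (w := w⁻¹) (by simpa using h)

theorem exists_tau_zpow_of_len_eq_zero {w : W r} (h : len w = 0) : ∃ m : ℤ, w = tau r ^ m := by
  obtain ⟨l, m, hlen, hw⟩ := exists_reduced_word w
  rw [h, List.length_eq_zero_iff] at hlen
  exact ⟨m, by simpa [hlen] using hw⟩

end Length

section RegularRepresentation

variable {k : Type*} [CommRing k] (q : k) {r : ℕ}

open Classical in
/-- Left multiplication by `T_{s_i}` on the Hecke algebra, transported to the free module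
on `W`. -/
noncomputable def leftOp (i : Fin (r + 1)) : Module.End k (W r →₀ k) :=
  Finsupp.linearCombination k fun w =>
    if len w < len (sAff i * w) then Finsupp.single (sAff i * w) 1
    else q • Finsupp.single (sAff i * w) 1 + (q - 1) • Finsupp.single w 1

open Classical in
/-- Right multiplication by `T_{s_j}` on the Hecke algebra, transported to the free module
on `W`. -/
noncomputable def rightOp (j : Fin (r + 1)) : Module.End k (W r →₀ k) :=
  Finsupp.linearCombination k fun w =>
    if len w < len (w * sAff j) then Finsupp.single (w * sAff j) 1
    else q • Finsupp.single (w * sAff j) 1 + (q - 1) • Finsupp.single w 1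

theorem leftOp_single (i : Fin (r + 1)) (w : W r) : leftOp q i (Finsupp.single w 1) =
    if len w < len (sAff i * w) then Finsupp.single (sAff i * w) 1
    else q • Finsupp.single (sAff i * w) 1 + (q - 1) • Finsupp.single w 1 := by
  simp only [leftOp, Finsupp.linearCombination_single, one_smul]

theorem rightOp_single (j : Fin (r + 1)) (w : W r) : rightOp q j (Finsupp.single w 1) =
    if len w < len (w * sAff j) then Finsupp.single (w * sAff j) 1
    else q • Finsupp.single (w * sAff j) 1 + (q - 1) • Finsupp.single w 1 := by
  simp only [rightOp, Finsupp.linearCombination_single, one_smul]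

/-- The endomorphisms commuting with all right multiplications by `T_{s_j}` and by powers
of `τ`; left multiplications live here. -/
noncomputable def commutant (r : ℕ) : Subalgebra k (Module.End k (W r →₀ k)) :=
  Subalgebra.centralizer k
    (Set.range (rightOp q) ∪ Set.range fun m : ℤ => Finsupp.lmapDomain k k (· * tau r ^ m))

variable {q}

theorem mem_commutant_iff {φ : Module.End k (W r →₀ k)} : φ ∈ commutant q r ↔
    (∀ j w, φ (rightOp q j (Finsupp.single w 1)) = rightOp q j (φ (Finsupp.single w 1))) ∧
      ∀ (m : ℤ) w, φ (Finsupp.single (w * tau r ^ m) 1) =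
        Finsupp.mapDomain (· * tau r ^ m) (φ (Finsupp.single w 1)) := by
  simp only [commutant, Subalgebra.mem_centralizer_iff, Set.mem_union, or_imp, forall_and,
    Set.forall_mem_range]
  refine and_congr (forall_congr' fun j => ?_) (forall_congr' fun m => ?_) <;>
  · rw [eq_comm]
    refine ⟨fun h w => ?_, fun h => Finsupp.lhom_ext' fun w => LinearMap.ext_ring ?_⟩
    · simpa using LinearMap.congr_fun h (Finsupp.single w 1)
    · simpa using h w

variable [NeZero r]

theorem len_mul_sAff_lt_sAff_mul_iff {w : W r} {i j : Fin (r + 1)}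
    (h : sAff i * w ≠ w * sAff j) :
    len (w * sAff j) < len (sAff i * (w * sAff j)) ↔ len w < len (sAff i * w) := by
  have hlen := len_sAff_mul (w * sAff j) i
  constructor <;> intro hlt <;> by_contra hnot
  · refine h ?_
    have := sAff_mul_eq_of_len_lt (w := w * sAff j) (j := j) hlt (by
      rw [sAff_mul_cancel_right]
      have := len_sAff_mul w i
      omega)
    rw [sAff_mul_cancel_right] at this
    rw [← congrArg (sAff i * ·) this, sAff_mul_cancel_left]
  · exact h (sAff_mul_eq_of_len_lt hlt (by omega))

theorem len_sAff_mul_lt_mul_sAff_iff {w : W r} {i j : Fin (r + 1)}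
    (h : sAff i * w ≠ w * sAff j) :
    len (sAff i * w) < len (sAff i * (w * sAff j)) ↔ len w < len (w * sAff j) := by
  have := len_mul_sAff_lt_sAff_mul_iff h
  have := len_sAff_mul w i
  have := len_mul_sAff w j
  have := len_sAff_mul (w * sAff j) i
  have := len_mul_sAff (sAff i * w) j
  rw [mul_assoc] at this
  omega

theorem leftOp_rightOp_single (i j : Fin (r + 1)) (w : W r) :
    leftOp q i (rightOp q j (Finsupp.single w 1)) =
      rightOp q j (leftOp q i (Finsupp.single w 1)) := by
  rw [rightOp_single, leftOp_single]
  by_cases heq : sAff i * w = w * sAff j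
  · have hcancel : sAff i * (w * sAff j) = w := by rw [← heq, sAff_mul_cancel_left]
    rw [heq]
    split_ifs <;> simp only [map_add, map_smul, leftOp_single, rightOp_single, heq, hcancel,
      sAff_mul_cancel_right]
  · have hleft := len_mul_sAff_lt_sAff_mul_iff heq
    have hright := len_sAff_mul_lt_mul_sAff_iff heq
    split_ifs with h h' h' <;>
      simp only [map_add, map_smul, leftOp_single, rightOp_single, mul_assoc, h, h', hleft, hright,
        if_true, if_false]
    module

theorem leftOp_mem_commutant (i : Fin (r + 1)) : leftOp q i ∈ commutant q r := by
  refine mem_commutant_iff.2 ⟨fun j w => leftOp_rightOp_single i j w, fun m w => ?_⟩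
  rw [leftOp_single, leftOp_single, ← mul_assoc, len_mul_tau_zpow, len_mul_tau_zpow]
  split_ifs <;> simp only [Finsupp.mapDomain_add, Finsupp.mapDomain_smul, Finsupp.mapDomain_single]

theorem lmapDomain_tau_zpow_mem_commutant (m : ℤ) :
    Finsupp.lmapDomain k k (tau r ^ m * ·) ∈ commutant q r := by
  refine mem_commutant_iff.2 ⟨fun j w => ?_, fun l w => by simp [mul_assoc]⟩
  rw [rightOp_single, Finsupp.lmapDomain_apply, Finsupp.lmapDomain_apply, Finsupp.mapDomain_single,
    rightOp_single, mul_assoc, len_tau_zpow_mul, len_tau_zpow_mul]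
  split_ifs <;> simp only [Finsupp.mapDomain_add, Finsupp.mapDomain_smul, Finsupp.mapDomain_single]

theorem commutant_ext {φ ψ : commutant q r}
    (h : φ.1 (Finsupp.single 1 1) = ψ.1 (Finsupp.single 1 1)) : φ = ψ := by
  obtain ⟨hφ, hφτ⟩ := mem_commutant_iff.1 φ.2
  obtain ⟨hψ, hψτ⟩ := mem_commutant_iff.1 ψ.2
  refine Subtype.ext (Finsupp.lhom_ext' fun w => LinearMap.ext_ring ?_)
  simp only [LinearMap.comp_apply, Finsupp.lsingle_apply]
  induction hn : len w generalizing w with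
  | zero =>
    obtain ⟨m, rfl⟩ := exists_tau_zpow_of_len_eq_zero hn
    rw [← one_mul (tau r ^ m), hφτ, hψτ, h]
  | succ n ih =>
    obtain ⟨j, hj⟩ := exists_right_descent (w := w) (by omega)
    have hw : Finsupp.single w (1 : k) = rightOp q j (Finsupp.single (w * sAff j) 1) := by
      rw [rightOp_single, sAff_mul_cancel_right, if_pos (by omega)]
    rw [hw, hφ, hψ, ih _ (by omega)]

theorem exists_mem_commutant_single (q : k) (w : W r) :
    ∃ φ : commutant q r, ∀ y, len (w * y) = len w + len y →
      φ.1 (Finsupp.single y 1) = Finsupp.single (w * y) 1 := by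
  induction hn : len w generalizing w with
  | zero =>
    obtain ⟨m, rfl⟩ := exists_tau_zpow_of_len_eq_zero hn
    exact ⟨⟨_, lmapDomain_tau_zpow_mem_commutant m⟩, fun y _ => by simp⟩
  | succ n ih =>
    obtain ⟨i, hi⟩ := exists_left_descent (w := w) (by omega)
    obtain ⟨φ, hφ⟩ := ih (sAff i * w) (by omega)
    refine ⟨⟨leftOp q i, leftOp_mem_commutant i⟩ * φ, fun y hy => ?_⟩
    have hle := len_mul_le (sAff i * w) y
    have hstep := len_sAff_mul (w * y) i
    rw [mul_assoc] at hle
    rw [MulMemClass.coe_mul, Module.End.mul_apply, hφ y (by rw [mul_assoc]; omega), leftOp_single,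
      mul_assoc, sAff_mul_cancel_left, if_pos (by omega)]

/-- The action of `T_w` by left multiplication on the free module on `W`. -/
noncomputable def opT (q : k) (w : W r) : commutant q r := (exists_mem_commutant_single q w).choose

theorem opT_single {w y : W r} (h : len (w * y) = len w + len y) :
    (opT q w).1 (Finsupp.single y 1) = Finsupp.single (w * y) 1 :=
  (exists_mem_commutant_single q w).choose_spec y h

theorem opT_single_one (w : W r) : (opT q w).1 (Finsupp.single 1 1) = Finsupp.single w 1 := by
  rw [opT_single, mul_one]
  rw [mul_one, len_one, add_zero]

theorem opT_one : opT q (1 : W r) = 1 := commutant_ext (opT_single_one 1)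

theorem opT_mul {x y : W r} (h : len (x * y) = len x + len y) :
    opT q x * opT q y = opT q (x * y) := by
  refine commutant_ext ?_
  rw [MulMemClass.coe_mul, Module.End.mul_apply, opT_single_one, opT_single_one, opT_single h]

theorem opT_sAff (i : Fin (r + 1)) : (opT q (sAff i)).1 = leftOp q i := by
  refine congrArg Subtype.val (commutant_ext (ψ := ⟨_, leftOp_mem_commutant i⟩) ?_)
  rw [opT_single_one, leftOp_single, mul_one, if_pos (by rw [len_sAff, len_one]; exact one_pos)]

theorem opT_sAff_mul_self (i : Fin (r + 1)) :
    opT q (sAff i) * opT q (sAff i) = q • (1 : commutant q r) + (q - 1) • opT q (sAff i) := by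
  have hlt : len (1 : W r) < len (sAff (r := r) i) := by rw [len_sAff, len_one]; exact one_pos
  refine commutant_ext ?_
  simp only [MulMemClass.coe_mul, AddMemClass.coe_add, SetLike.val_smul, OneMemClass.coe_one,
    opT_sAff, Module.End.mul_apply, LinearMap.add_apply, LinearMap.smul_apply,
    Module.End.one_apply, leftOp_single, mul_one, sAff_mul_self, hlt, hlt.not_gt, if_true, if_false]

end RegularRepresentation

section Basis

variable {k : Type*} [Field k] (q : k) {r : ℕ}

/-- The projection from the free algebra on `W` onto the Hecke algebra. -/
noncomputable def mkHecke (r : ℕ) : FreeAlgebra k (W r) →ₐ[k] Hecke q r :=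
  RingQuot.mkAlgHom k (HeckeRel q r)

theorem mkHecke_ι (w : W r) : mkHecke q r (FreeAlgebra.ι k w) = T q w := rfl

theorem mkHecke_eq_of_rel {a b : FreeAlgebra k (W r)} (h : HeckeRel q r a b) :
    mkHecke q r a = mkHecke q r b :=
  RingQuot.mkAlgHom_rel k h

theorem mkHecke_surjective : Function.Surjective (mkHecke q r) :=
  RingQuot.mkAlgHom_surjective k (HeckeRel q r)

theorem T_one : T q (1 : W r) = 1 := by
  simpa only [map_one, mkHecke_ι] using mkHecke_eq_of_rel q (.one (q := q) (r := r))

theorem T_mul {x y : W r} (h : len (x * y) = len x + len y) : T q x * T q y = T q (x * y) := by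
  simpa only [map_mul, mkHecke_ι] using mkHecke_eq_of_rel q (.mul x y h)

theorem T_sAff_mul_self (i : Fin (r + 1)) :
    T q (sAff i) * T q (sAff i) = q • (1 : Hecke q r) + (q - 1) • T q (sAff i) := by
  have h := mkHecke_eq_of_rel q (.quad i)
  simp only [map_mul, map_sub, map_add, map_zero, map_one, AlgHom.commutes, mkHecke_ι] at h
  rw [Algebra.algebraMap_eq_smul_one, sub_mul, mul_add, mul_one, smul_mul_assoc, one_mul,
    smul_add] at h
  rw [← sub_eq_zero, ← h]
  module

theorem adjoin_range_T : Algebra.adjoin k (Set.range (T q (r := r))) = ⊤ := by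
  have h := (mkHecke q r).map_adjoin (Set.range (FreeAlgebra.ι k))
  rw [FreeAlgebra.adjoin_range_ι, Algebra.map_top, (AlgHom.range_eq_top _).2 (mkHecke_surjective q),
    ← Set.range_comp] at h
  exact h.symm

variable [NeZero r]

variable (r) in
/-- The regular representation of the Hecke algebra, on the free module on `W`. -/
noncomputable def rep : Hecke q r →ₐ[k] Module.End k (W r →₀ k) :=
  RingQuot.liftAlgHom k ⟨FreeAlgebra.lift k fun w => (opT q w).1, fun _ _ h => by
    induction h with
    | one => simp only [FreeAlgebra.lift_ι_apply, map_one, opT_one, OneMemClass.coe_one]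
    | mul x y h =>
      simp only [map_mul, FreeAlgebra.lift_ι_apply, ← MulMemClass.coe_mul, opT_mul h]
    | quad i =>
      have hquad := congrArg Subtype.val (opT_sAff_mul_self (q := q) i)
      simp only [MulMemClass.coe_mul, AddMemClass.coe_add, SetLike.val_smul,
        OneMemClass.coe_one] at hquad
      simp only [map_mul, map_sub, map_add, map_zero, FreeAlgebra.lift_ι_apply,
        AlgHom.commutes, sub_mul, mul_add, mul_one, hquad]
      simp only [Algebra.algebraMap_eq_smul_one, smul_mul_assoc, one_mul]
      module⟩

theorem rep_T (w : W r) : rep q r (T q w) = (opT q w).1 :=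
  (RingQuot.liftAlgHom_mkAlgHom_apply k _ _ _).trans (FreeAlgebra.lift_ι_apply _ _)

theorem linearIndependent_T : LinearIndependent k (T q (r := r)) := by
  refine LinearIndependent.of_comp (LinearMap.applyₗ (Finsupp.single 1 1) ∘ₗ
    (rep q r).toLinearMap) ?_
  convert Finsupp.linearIndependent_single_one k (W r) using 1
  funext w
  simp [rep_T, opT_single_one]

theorem T_sAff_mul_of_lt {i : Fin (r + 1)} {w : W r} (h : len w < len (sAff i * w)) :
    T q (sAff i) * T q w = T q (sAff i * w) := by
  refine T_mul q ?_
  have := len_sAff_mul w i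
  rw [len_sAff]
  omega

theorem T_sAff_mul_of_not_lt {i : Fin (r + 1)} {w : W r} (h : ¬ len w < len (sAff i * w)) :
    T q (sAff i) * T q w = q • T q (sAff i * w) + (q - 1) • T q w := by
  have hw : T q (sAff i) * T q (sAff i * w) = T q w := by
    rw [T_sAff_mul_of_lt, sAff_mul_cancel_left]
    have := len_sAff_mul w i
    rw [sAff_mul_cancel_left]
    omega
  rw [← hw, ← mul_assoc, T_sAff_mul_self, add_mul, smul_mul_assoc, one_mul, smul_mul_assoc, hw]

theorem T_sAff_mul_mem_span (i : Fin (r + 1)) {h : Hecke q r}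
    (hh : h ∈ Submodule.span k (Set.range (T q (r := r)))) :
    T q (sAff i) * h ∈ Submodule.span k (Set.range (T q (r := r))) := by
  have hT (w : W r) : T q w ∈ Submodule.span k (Set.range (T q (r := r))) :=
    Submodule.subset_span ⟨w, rfl⟩
  refine (Submodule.span_le (p := (Submodule.span k (Set.range (T q (r := r)))).comap
    (LinearMap.mulLeft k (T q (sAff i))))).2 ?_ hh
  rintro _ ⟨w, rfl⟩
  rw [SetLike.mem_coe, Submodule.mem_comap, LinearMap.mulLeft_apply]
  by_cases hw : len w < len (sAff i * w)
  · rw [T_sAff_mul_of_lt q hw]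
    exact hT _
  · rw [T_sAff_mul_of_not_lt q hw]
    exact add_mem (Submodule.smul_mem _ _ (hT _)) (Submodule.smul_mem _ _ (hT _))

theorem T_mul_mem_span (w : W r) {h : Hecke q r}
    (hh : h ∈ Submodule.span k (Set.range (T q (r := r)))) :
    T q w * h ∈ Submodule.span k (Set.range (T q (r := r))) := by
  induction hn : len w generalizing w with
  | zero =>
    obtain ⟨m, rfl⟩ := exists_tau_zpow_of_len_eq_zero hn
    refine (Submodule.span_le (p := (Submodule.span k (Set.range (T q (r := r)))).comap
      (LinearMap.mulLeft k (T q (tau r ^ m))))).2 ?_ hh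
    rintro _ ⟨y, rfl⟩
    rw [SetLike.mem_coe, Submodule.mem_comap, LinearMap.mulLeft_apply,
      T_mul q (by rw [len_tau_zpow_mul, len_tau_zpow, zero_add])]
    exact Submodule.subset_span ⟨_, rfl⟩
  | succ n ih =>
    obtain ⟨i, hi⟩ := exists_left_descent (w := w) (by omega)
    have hw := T_sAff_mul_of_lt q (i := i) (w := sAff i * w) (by rw [sAff_mul_cancel_left]; omega)
    rw [sAff_mul_cancel_left] at hw
    rw [← hw, mul_assoc]
    exact T_sAff_mul_mem_span q i (ih (sAff i * w) (by omega))

theorem span_T : Submodule.span k (Set.range (T q (r := r))) = ⊤ := by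
  rw [← top_le_iff, ← Algebra.top_toSubmodule, ← adjoin_range_T, Algebra.adjoin_eq_span,
    Submodule.span_le]
  intro h hh
  induction hh using Submonoid.closure_induction_left with
  | one => exact T_one q ▸ Submodule.subset_span ⟨1, rfl⟩
  | mul_left x hx y _ hy =>
    obtain ⟨w, rfl⟩ := hx
    exact T_mul_mem_span q w hy

variable (r) in
/-- The basis `T_w` of the Hecke algebra. -/
noncomputable def basisT : Module.Basis (W r) k (Hecke q r) :=
  Module.Basis.mk (linearIndependent_T q) (span_T q).ge

theorem basisT_apply (w : W r) : basisT q r w = T q w := by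
  rw [basisT, Module.Basis.mk_apply]

theorem repr_T (w : W r) : (basisT q r).repr (T q w) = Finsupp.single w 1 := by
  rw [← basisT_apply, Module.Basis.repr_self]

end Basis

section Combinatorics

variable {r : ℕ}

theorem perm_mul (σ ρ : Equiv.Perm (Fin (r + 1))) : perm (σ * ρ) = perm σ * perm ρ := map_mul _ _ _

theorem perm_inv (σ : Equiv.Perm (Fin (r + 1))) : perm σ⁻¹ = (perm σ)⁻¹ := map_inv _ _

theorem perm_injective : Function.Injective (perm (r := r)) := SemidirectProduct.inr_injective

theorem mono_injective : Function.Injective (mono (r := r)) :=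
  SemidirectProduct.inl_injective.comp Multiplicative.ofAdd.injective

theorem var_injective : Function.Injective (var (r := r)) :=
  mono_injective.comp fun i j h => by
    have := congrFun h i
    by_contra hij
    simp [hij] at this

theorem s_mul_self (i : Fin r) : s i * s i = 1 := by
  rw [s, ← perm_mul, Equiv.swap_mul_self, perm, map_one]

theorem s_inv (i : Fin r) : (s i)⁻¹ = s i := inv_eq_of_mul_eq_one_left (s_mul_self i)

theorem s_injective : Function.Injective (s (r := r)) := by
  intro i j h
  have hswap := congrArg (fun σ => σ i.castSucc) (perm_injective h)
  simp only [Equiv.swap_apply_left, Equiv.swap_apply_def] at hswap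
  apply Fin.ext
  split_ifs at hswap <;>
    simp only [Fin.ext_iff, Fin.val_succ, Fin.val_castSucc] at * <;> omega

theorem perm_conj_mono (σ : Equiv.Perm (Fin (r + 1))) (a : Fin (r + 1) → ℤ) :
    perm σ * mono a * (perm σ)⁻¹ = mono fun i => a (σ⁻¹ i) := by
  rw [← perm_inv, perm, mono, perm, ← SemidirectProduct.inl_aut]
  rfl

theorem perm_conj_var (σ : Equiv.Perm (Fin (r + 1))) (i : Fin (r + 1)) :
    perm σ * var i * (perm σ)⁻¹ = var (σ i) := by
  rw [var, perm_conj_mono, var]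
  congr 1
  funext j
  simp only [Pi.single_apply, Equiv.Perm.inv_eq_iff_eq]

theorem right_perm_mul_mono (w : Equiv.Perm (Fin (r + 1))) (p : Fin (r + 1) → ℤ) :
    (perm w * mono p).right = w := by
  simp [perm, mono]

theorem exists_eq_perm_mul_mono (d : W r) : ∃ a, d = perm d.right * mono a := by
  have hd : mono d.left.toAdd * perm d.right = d := SemidirectProduct.inl_left_mul_inr_right d
  have hconj := perm_conj_mono d.right fun i => d.left.toAdd (d.right i)
  simp only [← Equiv.Perm.mul_apply, mul_inv_cancel, Equiv.Perm.one_apply] at hconj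
  exact ⟨_, by rw [mul_inv_eq_iff_eq_mul.1 hconj, hd]⟩

section Parabolic

variable {K J : Finset (Fin r)}

theorem s_mem_parabolic {i : Fin r} (hi : i ∈ J) : s i ∈ parabolic J :=
  Subgroup.subset_closure ⟨i, hi, rfl⟩

theorem parabolic_mono (h : J ⊆ K) : parabolic J ≤ parabolic K :=
  Subgroup.closure_mono (Set.image_mono h)

theorem parabolic_empty : parabolic (∅ : Finset (Fin r)) = ⊥ := by
  simp [parabolic]

theorem exists_perm_of_mem {x : W r} (hx : x ∈ parabolic J) : ∃ σ, x = perm σ := by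
  have h : parabolic J ≤ (SemidirectProduct.inr : Equiv.Perm (Fin (r + 1)) →* W r).range := by
    rw [parabolic, Subgroup.closure_le]
    rintro _ ⟨i, -, rfl⟩
    exact ⟨_, rfl⟩
  obtain ⟨σ, rfl⟩ := h hx
  exact ⟨σ, rfl⟩

theorem perm_right {x : W r} (hx : x ∈ parabolic J) : perm x.right = x := by
  obtain ⟨σ, rfl⟩ := exists_perm_of_mem hx
  rfl

theorem right_le_castSucc_iff {i : Fin r} (hi : i ∉ J) {g : W r} (hg : g ∈ parabolic J)
    (x : Fin (r + 1)) : g.right x ≤ i.castSucc ↔ x ≤ i.castSucc := by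
  induction hg using Subgroup.closure_induction generalizing x with
  | mem g hg =>
    obtain ⟨j, hj, rfl⟩ := hg
    have hji : (j : ℕ) ≠ i := fun h => hi (Fin.ext h ▸ hj)
    change Equiv.swap j.castSucc j.succ x ≤ _ ↔ _
    rw [Equiv.swap_apply_def]
    split_ifs <;>
      simp only [Fin.le_def, Fin.ext_iff, Fin.val_succ, Fin.val_castSucc] at * <;> omega
  | one => rfl
  | mul g h _ _ hg hh => rw [SemidirectProduct.mul_right, Equiv.Perm.mul_apply, hg, hh]
  | inv g _ hg => rw [SemidirectProduct.inv_right, ← hg, ← Equiv.Perm.mul_apply, mul_inv_cancel,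
      Equiv.Perm.one_apply]

theorem mem_dcoset_self (K J : Finset (Fin r)) (d : W r) : d ∈ dcoset K J d :=
  ⟨1, one_mem _, 1, one_mem _, by simp⟩

theorem dcoset_eq {d u : W r} (hu : u ∈ dcoset K J d) : dcoset K J u = dcoset K J d := by
  obtain ⟨a, ha, b, hb, rfl⟩ := hu
  ext z
  constructor
  · rintro ⟨x, hx, y, hy, rfl⟩
    exact ⟨x * a, mul_mem hx ha, b * y, mul_mem hb hy, by simp only [mul_assoc]⟩
  · rintro ⟨x, hx, y, hy, rfl⟩
    exact ⟨x * a⁻¹, mul_mem hx (inv_mem ha), b⁻¹ * y, mul_mem (inv_mem hb) hy, by group⟩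

theorem mem_dcoset_symm {d u : W r} (hu : u ∈ dcoset K J d) : d ∈ dcoset K J u := by
  rw [dcoset_eq hu]
  exact mem_dcoset_self K J d

theorem mul_left_mem_dcoset_iff {d u x : W r} (hx : x ∈ parabolic K) :
    x * u ∈ dcoset K J d ↔ u ∈ dcoset K J d := by
  constructor
  · rintro ⟨a, ha, b, hb, h⟩
    exact ⟨x⁻¹ * a, mul_mem (inv_mem hx) ha, b, hb, by
      rw [mul_assoc x⁻¹, mul_assoc x⁻¹, ← h, inv_mul_cancel_left]⟩
  · rintro ⟨a, ha, b, hb, rfl⟩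
    exact ⟨x * a, mul_mem hx ha, b, hb, by simp only [mul_assoc]⟩

theorem perm_right_mem_dcoset {z d : W r} (h : z ∈ dcoset K J d) :
    perm z.right ∈ dcoset K J (perm d.right) := by
  obtain ⟨x, hx, y, hy, rfl⟩ := h
  refine ⟨x, hx, y, hy, ?_⟩
  rw [SemidirectProduct.mul_right, SemidirectProduct.mul_right, perm_mul, perm_mul, perm_right hx,
    perm_right hy]

end Parabolic

section Descents

variable [NeZero r] {J : Finset (Fin r)}

theorem len_s (i : Fin r) : len (s i) = 1 := len_sAff i.succ

theorem len_perm_lt_mul_s_iff (σ : Equiv.Perm (Fin (r + 1))) (i : Fin r) :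
    len (perm σ) < len (perm σ * s i) ↔ σ i.castSucc < σ i.succ := by
  have hpred : ((i.succ : Fin (r + 1)) : ℤ) - 1 = (i.castSucc : Fin (r + 1)) := by simp
  rw [← sAff_succ, len_lt_mul_sAff_iff, hpred, perm_smul_coe, perm_smul_coe, Nat.cast_lt,
    Fin.lt_def]

theorem len_perm_lt_mul_sAff_zero (σ : Equiv.Perm (Fin (r + 1))) :
    len (perm σ) < len (perm σ * sAff 0) := by
  have hpred : (((0 : Fin (r + 1)) : ℤ)) - 1 = (Fin.last r : ℤ) + (r + 1 : ℤ) * (-1) := by simp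
  rw [len_lt_mul_sAff_iff, hpred, perm_smul_coe_add, perm_smul_coe]
  omega

theorem perm_eq_one_of_len_eq_zero {σ : Equiv.Perm (Fin (r + 1))} (h : len (perm σ) = 0) :
    perm σ = 1 := by
  obtain ⟨m, hm⟩ := exists_tau_zpow_of_len_eq_zero h
  have hzero := congrArg (· • ((0 : Fin (r + 1)) : ℤ)) hm
  have hlast := congrArg (· • (Fin.last r : ℤ)) hm
  rw [perm_smul_coe, tau_zpow_smul] at hzero hlast
  rw [Fin.val_zero] at hzero
  rw [Fin.val_last] at hlast
  rw [hm, show m = 0 by omega, zpow_zero]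

theorem eq_one_of_len_eq_zero {x : W r} (hx : x ∈ parabolic J) (h : len x = 0) : x = 1 := by
  obtain ⟨σ, rfl⟩ := exists_perm_of_mem hx
  exact perm_eq_one_of_len_eq_zero h

theorem len_ne_zero {x : W r} (hx : x ∈ parabolic J) (h : x ≠ 1) : len x ≠ 0 :=
  mt (eq_one_of_len_eq_zero hx) h

theorem exists_parabolic_right_descent {x : W r} (hx : x ∈ parabolic J) (h : x ≠ 1) :
    ∃ i ∈ J, ∃ y ∈ parabolic J, x = y * s i ∧ len x = len y + 1 := by
  obtain ⟨j, hj⟩ := exists_right_descent (len_ne_zero hx h)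
  obtain ⟨σ, rfl⟩ := exists_perm_of_mem hx
  cases j using Fin.cases with
  | zero => exact absurd (len_perm_lt_mul_sAff_zero σ) (by omega)
  | succ i =>
    rw [sAff_succ] at hj
    have hlt : ¬ σ i.castSucc < σ i.succ := by
      rw [← len_perm_lt_mul_s_iff]
      omega
    have hi : i ∈ J := by
      by_contra hi
      have hle := (right_le_castSucc_iff hi hx i.castSucc).2 le_rfl
      have hgt := mt (right_le_castSucc_iff hi hx i.succ).1 Fin.castSucc_lt_succ.not_ge
      exact hlt (hle.trans_lt (not_le.1 hgt))
    exact ⟨i, hi, _, mul_mem hx (s_mem_parabolic hi), by rw [mul_assoc, s_mul_self, mul_one],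
      hj.symm⟩

theorem exists_parabolic_left_descent {x : W r} (hx : x ∈ parabolic J) (h : x ≠ 1) :
    ∃ i ∈ J, ∃ y ∈ parabolic J, x = s i * y ∧ len x = len y + 1 := by
  obtain ⟨i, hi, y, hy, hxy, hlen⟩ := exists_parabolic_right_descent (inv_mem hx) (inv_ne_one.2 h)
  refine ⟨i, hi, y⁻¹, inv_mem hy, ?_, by rwa [len_inv, ← len_inv x]⟩
  rw [← inv_inv x, hxy, mul_inv_rev, s_inv]

theorem exists_eq_s_of_len_eq_one {x : W r} (hx : x ∈ parabolic J) (h : len x = 1) :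
    ∃ i ∈ J, x = s i := by
  obtain ⟨i, hi, y, hy, rfl, hlen⟩ := exists_parabolic_left_descent hx
    (by rintro rfl; simp [len_one] at h)
  exact ⟨i, hi, by rw [eq_one_of_len_eq_zero hy (by omega), mul_one]⟩

end Descents

section Reflections

variable [NeZero r] {i : Fin (r + 1)} {g h : W r}

theorem len_reflection_mul_lt (hg : len g < len (sAff i * g))
    (hgh : len (sAff i * (g * h)) < len (g * h)) : len (g⁻¹ * sAff i * g * h) < len h := by
  induction hn : len h generalizing g h with
  | zero =>
    obtain ⟨m, rfl⟩ := exists_tau_zpow_of_len_eq_zero hn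
    rw [← mul_assoc, len_mul_tau_zpow, len_mul_tau_zpow] at hgh
    omega
  | succ n ih =>
    obtain ⟨j, hj⟩ := exists_left_descent (w := h) (by omega)
    by_cases hgj : len (sAff i * (g * sAff j)) < len (g * sAff j)
    · rw [mul_assoc g⁻¹, sAff_mul_eq_of_len_lt hg hgj, inv_mul_cancel_left]
      omega
    · have hih := ih (g := g * sAff j) (h := sAff j * h)
        (by have := len_sAff_mul (g * sAff j) i; omega) (by simpa [mul_assoc] using hgh) (by omega)
      have hstep := len_sAff_mul (g⁻¹ * sAff i * g * h) j
      rw [show (g * sAff j)⁻¹ * sAff i * (g * sAff j) * (sAff j * h) =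
        sAff j * (g⁻¹ * sAff i * g * h) by simp [mul_assoc]] at hih
      omega

theorem reflection_mem_parabolic {J : Finset (Fin r)} (hh : h ∈ parabolic J)
    (hg : len g < len (sAff i * g)) (hgh : len (sAff i * (g * h)) < len (g * h)) :
    g⁻¹ * sAff i * g ∈ parabolic J := by
  induction hn : len h generalizing g h with
  | zero =>
    rw [eq_one_of_len_eq_zero hh hn, mul_one] at hgh
    omega
  | succ n ih =>
    obtain ⟨j, hj, y, hy, rfl, hlen⟩ := exists_parabolic_left_descent hh
      (by rintro rfl; simp [len_one] at hn)
    have hs := s_mem_parabolic hj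
    by_cases hgj : len (sAff i * (g * s j)) < len (g * s j)
    · rw [← sAff_succ] at hgj
      rwa [mul_assoc, sAff_mul_eq_of_len_lt hg hgj, inv_mul_cancel_left, sAff_succ]
    · have hih := ih hy (g := g * s j) (by have := len_sAff_mul (g * s j) i; omega)
        (by rwa [mul_assoc g]) (by omega)
      have hconj : g⁻¹ * sAff i * g = s j * ((g * s j)⁻¹ * sAff i * (g * s j)) * s j := by
        simp only [mul_inv_rev, s_inv, mul_assoc, s_mul_self, mul_one]
        rw [← mul_assoc (s j), s_mul_self, one_mul]
      rw [hconj]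
      exact mul_mem (mul_mem hs hih) hs

end Reflections

section MinimalCosetRepresentatives

variable {K J : Finset (Fin r)} {g h : W r}

/-- `g` has minimal length in its coset `W_K g`. -/
def LeftMin (K : Finset (Fin r)) (g : W r) : Prop := ∀ x ∈ parabolic K, len g ≤ len (x * g)

/-- `g` has minimal length in its coset `g W_K`. -/
def RightMin (K : Finset (Fin r)) (g : W r) : Prop := ∀ x ∈ parabolic K, len g ≤ len (g * x)

theorem exists_leftMin (K : Finset (Fin r)) (g : W r) :
    ∃ x ∈ parabolic K, LeftMin K (x * g) := by
  obtain ⟨x, hx, h⟩ := Set.exists_min_image _ (fun x => len (x * g)) (parabolic_finite K)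
    ⟨1, one_mem _⟩
  exact ⟨x, hx, fun y hy => mul_assoc y x g ▸ h _ (mul_mem hy hx)⟩

variable [NeZero r]

theorem rightMin_iff : RightMin K g ↔ LeftMin K g⁻¹ := by
  constructor
  · intro h x hx
    have := h x⁻¹ (inv_mem hx)
    rwa [← len_inv, ← len_inv (g * _), mul_inv_rev, inv_inv] at this
  · intro h x hx
    have := h x⁻¹ (inv_mem hx)
    rwa [← mul_inv_rev, len_inv, len_inv] at this

theorem LeftMin.len_mul (hg : LeftMin K g) {x : W r} (hx : x ∈ parabolic K) :
    len (x * g) = len x + len g := by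
  induction hn : len x generalizing x with
  | zero => rw [eq_one_of_len_eq_zero hx hn, one_mul, zero_add]
  | succ n ih =>
    obtain ⟨i, hi, y, hy, rfl, hlen⟩ := exists_parabolic_left_descent hx
      (by rintro rfl; simp [len_one] at hn)
    have hyg := ih hy (by omega)
    by_contra hne
    have hlt : len (s i * (y * g)) < len (y * g) := by
      have := len_sAff_mul (y * g) i.succ
      rw [sAff_succ] at this
      rw [mul_assoc] at hne
      omega
    have hrefl := len_reflection_mul_lt (i := i.succ) (by rw [sAff_succ]; omega) hlt
    have hmem : y⁻¹ * s i * y ∈ parabolic K :=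
      mul_mem (mul_mem (inv_mem hy) (s_mem_parabolic hi)) hy
    exact (hg _ hmem).not_gt hrefl

theorem RightMin.len_mul (hg : RightMin K g) {x : W r} (hx : x ∈ parabolic K) :
    len (g * x) = len g + len x := by
  have := (rightMin_iff.1 hg).len_mul (inv_mem hx)
  rwa [← mul_inv_rev, len_inv, len_inv, len_inv, add_comm (len x)] at this

theorem RightMin.eq_one_of_mul (hg : RightMin K g) {x : W r} (hx : x ∈ parabolic K)
    (hgx : RightMin K (g * x)) : x = 1 := by
  have hle := hgx x⁻¹ (inv_mem hx)
  rw [mul_inv_cancel_right, hg.len_mul hx] at hle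
  exact eq_one_of_len_eq_zero hx (by omega)

theorem eq_of_mul_eq_mul_of_min (hgK : LeftMin K g) (hgJ : RightMin J g) (hhK : LeftMin K h)
    (hhJ : RightMin J h) {x y : W r} (hx : x ∈ parabolic K) (hy : y ∈ parabolic J)
    (e : x * g = h * y) : g = h := by
  induction hn : len x generalizing x y with
  | zero =>
    rw [eq_one_of_len_eq_zero hx hn, one_mul] at e
    rw [e, hhJ.eq_one_of_mul hy (e ▸ hgJ), mul_one]
  | succ n ih =>
    obtain ⟨i, hi, x', hx', rfl, hlen⟩ := exists_parabolic_left_descent hx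
      (by rintro rfl; simp [len_one] at hn)
    have e' : x' * g = h * (h⁻¹ * s i * h * y) := by
      simp only [mul_assoc, mul_inv_cancel_left]
      rw [← e, mul_assoc, ← mul_assoc (s i), s_mul_self, one_mul]
    refine ih hx' (mul_mem (reflection_mem_parabolic (i := i.succ) hy ?_ ?_) hy) e' (by omega)
    · rw [sAff_succ, hhK.len_mul (s_mem_parabolic hi), len_s]
      omega
    · rw [sAff_succ, ← e, mul_assoc, ← mul_assoc, s_mul_self, one_mul, ← mul_assoc,
        hgK.len_mul hx, hgK.len_mul hx']
      omega

end MinimalCosetRepresentatives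

section Shortest

variable {K J : Finset (Fin r)} {w : Equiv.Perm (Fin (r + 1))}

theorem leftMin_of_shortest (hw : w ∈ shortest K J) : LeftMin K (perm w) := fun x hx =>
  hw _ ⟨x, hx, 1, one_mem _, by simp⟩

theorem rightMin_of_shortest (hw : w ∈ shortest K J) : RightMin J (perm w) := fun y hy =>
  hw _ ⟨1, one_mem _, y, hy, by simp⟩

theorem shortest_unique [NeZero r] {w' : Equiv.Perm (Fin (r + 1))} (hw : w ∈ shortest K J)
    (hw' : w' ∈ shortest K J) (h : perm w' ∈ dcoset K J (perm w)) : w' = w := by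
  obtain ⟨x, hx, y, hy, e⟩ := h
  exact perm_injective (eq_of_mul_eq_mul_of_min (leftMin_of_shortest hw')
    (rightMin_of_shortest hw') (leftMin_of_shortest hw) (rightMin_of_shortest hw) (inv_mem hx) hy
    (by rw [e]; group))

theorem exists_shortest (K J : Finset (Fin r)) (σ : Equiv.Perm (Fin (r + 1))) :
    ∃ w ∈ shortest K J, perm σ ∈ dcoset K J (perm w) := by
  obtain ⟨u, hu, hmin⟩ := Set.exists_min_image _ len (dcoset_finite K J (perm σ))
    ⟨_, mem_dcoset_self _ _ _⟩
  obtain ⟨ρ, rfl⟩ : ∃ ρ, u = perm ρ := by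
    obtain ⟨x, hx, y, hy, rfl⟩ := hu
    obtain ⟨_, rfl⟩ := exists_perm_of_mem hx
    obtain ⟨_, rfl⟩ := exists_perm_of_mem hy
    exact ⟨_, by rw [← perm_mul, ← perm_mul]⟩
  exact ⟨ρ, fun v hv => hmin v (dcoset_eq hu ▸ hv), mem_dcoset_symm hu⟩

end Shortest

section Meet

variable {K₁ K₂ J : Finset (Fin r)} {w : Equiv.Perm (Fin (r + 1))}

theorem mem_meet_iff {i : Fin r} :
    i ∈ meet K₁ K₂ w ↔ i ∈ K₁ ∧ ∃ j ∈ K₂, perm w * s i * (perm w)⁻¹ = s j := by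
  simp [meet]

theorem mem_conj_iff {j : Fin r} :
    j ∈ conj w J ↔ ∃ i ∈ J, perm w * s i * (perm w)⁻¹ = s j := by
  simp [conj]

theorem meet_subset (K₁ K₂ : Finset (Fin r)) (w : Equiv.Perm (Fin (r + 1))) :
    meet K₁ K₂ w ⊆ K₁ := fun _ hi => (mem_meet_iff.1 hi).1

theorem conj_meet_subset (K₁ K₂ : Finset (Fin r)) (w : Equiv.Perm (Fin (r + 1))) :
    conj w (meet K₁ K₂ w) ⊆ K₂ := by
  intro j hj
  obtain ⟨i, hi, h⟩ := mem_conj_iff.1 hj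
  obtain ⟨-, j', hj', h'⟩ := mem_meet_iff.1 hi
  rwa [← s_injective (h'.symm.trans h)]

theorem conj_mem_parabolic {x : W r} (hx : x ∈ parabolic (meet K₁ K₂ w)) :
    perm w * x * (perm w)⁻¹ ∈ parabolic (conj w (meet K₁ K₂ w)) := by
  have hle : parabolic (meet K₁ K₂ w) ≤
      (parabolic (conj w (meet K₁ K₂ w))).comap (MulAut.conj (perm w)).toMonoidHom := by
    refine (Subgroup.closure_le _).2 ?_
    rintro _ ⟨i, hi, rfl⟩
    obtain ⟨-, j, -, h⟩ := mem_meet_iff.1 hi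
    change perm w * s i * (perm w)⁻¹ ∈ parabolic (conj w (meet K₁ K₂ w))
    rw [h]
    exact s_mem_parabolic (mem_conj_iff.2 ⟨i, hi, h⟩)
  exact hle hx

theorem mem_parabolic_meet [NeZero r] (hwl : LeftMin K₂ (perm w)) (hwr : RightMin K₁ (perm w))
    {y : W r} (hy : y ∈ parabolic K₁) (h : perm w * y * (perm w)⁻¹ ∈ parabolic K₂) :
    y ∈ parabolic (meet K₁ K₂ w) := by
  induction hn : len y generalizing y with
  | zero =>
    rw [eq_one_of_len_eq_zero hy hn]
    exact one_mem _
  | succ n ih =>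
    obtain ⟨a, ha, y', hy', rfl, hlen⟩ := exists_parabolic_left_descent hy
      (by rintro rfl; simp [len_one] at hn)
    have hsa := s_mem_parabolic ha
    have len_mul_inv {x : W r} (hx : x ∈ parabolic K₁) := (rightMin_iff.1 hwr).len_mul hx
    have e : (perm w)⁻¹ * (perm w * (s a * y') * (perm w)⁻¹) = s a * y' * (perm w)⁻¹ := by group
    have hz : perm w * s a * (perm w)⁻¹ ∈ parabolic K₂ := by
      have := reflection_mem_parabolic (i := a.succ) (g := (perm w)⁻¹) h
        (by rw [sAff_succ, len_mul_inv hsa, len_s]; omega)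
        (by
          rw [e, sAff_succ, len_mul_inv hy, mul_assoc, ← mul_assoc, s_mul_self, one_mul,
            len_mul_inv hy']
          omega)
      rwa [inv_inv, sAff_succ] at this
    have hzlen : len (perm w * s a * (perm w)⁻¹) = 1 := by
      have := hwl.len_mul hz
      rw [inv_mul_cancel_right, hwr.len_mul hsa, len_s] at this
      omega
    obtain ⟨j, hj, hzj⟩ := exists_eq_s_of_len_eq_one hz hzlen
    have hy'K : perm w * y' * (perm w)⁻¹ ∈ parabolic K₂ := by
      convert mul_mem (inv_mem hz) h using 1
      group
    exact mul_mem (s_mem_parabolic (mem_meet_iff.2 ⟨ha, j, hj, hzj⟩)) (ih hy' hy'K (by omega))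

end Meet

section Dominant

variable {J : Finset (Fin r)} {a a' : Fin (r + 1) → ℤ}

theorem dominant_iff : Dominant J a ↔ ∀ i ∈ J, a i.succ ≤ a i.castSucc := by
  constructor
  · intro h i hi
    refine h _ _ Fin.castSucc_lt_succ.le ⟨s i, s_mem_parabolic hi, ?_⟩
    rw [s, perm_conj_var, Equiv.swap_apply_left]
  · rintro h i j hij ⟨g, hg, hgi⟩
    have hgij : g.right i = j := var_injective (by rw [← perm_conj_var, perm_right hg, hgi])
    -- Every simple reflection between the positions `i` and `j` belongs to `J`.
    suffices key : ∀ m, i ≤ m → m ≤ j → a m ≤ a i from key j hij le_rfl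
    intro m
    induction m using Fin.induction with
    | zero => rintro him -; rw [Fin.le_zero_iff.1 him]
    | succ k ih =>
      intro him hmj
      rcases him.eq_or_lt with rfl | him
      · exact le_rfl
      have hik : i ≤ k.castSucc := Fin.le_castSucc_iff.2 him
      have hkj : k.castSucc < j := Fin.castSucc_lt_succ.trans_le hmj
      have hk : k ∈ J := by
        by_contra hk
        exact hkj.not_ge (hgij ▸ (right_le_castSucc_iff hk hg i).2 hik)
      exact (h k hk).trans (ih hik hkj.le)

theorem exists_dominant (J : Finset (Fin r)) (a : Fin (r + 1) → ℤ) :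
    ∃ g ∈ parabolic J, ∃ a', Dominant J a' ∧ g * mono a * g⁻¹ = mono a' := by
  obtain ⟨g, hg, hmax⟩ := Set.exists_max_image _ (fun g : W r => toLex fun i => a (g.right⁻¹ i))
    (parabolic_finite J) ⟨1, one_mem _⟩
  obtain ⟨σ, rfl⟩ := exists_perm_of_mem hg
  refine ⟨_, hg, _, dominant_iff.2 fun i hi => ?_, perm_conj_mono σ a⟩
  by_contra! hlt
  -- Exchanging the entries `i` and `i + 1` would give a lexicographically larger vector.
  set c : Fin (r + 1) → ℤ := fun x => a (σ⁻¹ x)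
  have hlex : toLex c < toLex (c ∘ Equiv.swap i.castSucc i.succ) := by
    have := Pi.lex_desc (f := c ∘ Equiv.swap i.castSucc i.succ) (j := i.succ)
      Fin.castSucc_lt_succ.le (by
        simpa only [Function.comp_apply, Equiv.swap_apply_left, Equiv.swap_apply_right] using hlt)
    rwa [Function.comp_assoc, ← Equiv.Perm.coe_mul, Equiv.swap_mul_self, Equiv.Perm.coe_one,
      Function.comp_id] at this
  refine hlex.not_ge ?_
  exact hmax (s i * perm σ) (mul_mem (s_mem_parabolic hi) hg)

theorem dominant_unique [NeZero r] (ha : Dominant J a) (ha' : Dominant J a') {g : W r}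
    (hg : g ∈ parabolic J) (h : g * mono a * g⁻¹ = mono a') : a = a' := by
  induction hn : len g generalizing g with
  | zero =>
    rw [eq_one_of_len_eq_zero hg hn, one_mul, inv_one, mul_one] at h
    exact mono_injective h
  | succ n ih =>
    obtain ⟨i, hi, y, hy, hgy, hlen⟩ := exists_parabolic_right_descent hg
      (by rintro rfl; simp [len_one] at hn)
    obtain ⟨ρ, rfl⟩ := exists_perm_of_mem hy
    subst hgy
    have hlt : ρ i.castSucc < ρ i.succ := (len_perm_lt_mul_s_iff ρ i).1 (by omega)
    have ha'ρ (x : Fin (r + 1)) : a' (ρ x) = a (Equiv.swap i.castSucc i.succ x) := by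
      rw [s, ← perm_mul, perm_conj_mono] at h
      simp [← mono_injective h]
    have hconj : perm ρ * s i * (perm ρ)⁻¹ * var (ρ i.castSucc) *
        (perm ρ * s i * (perm ρ)⁻¹)⁻¹ = var (ρ i.succ) := by
      rw [s, ← perm_mul, ← perm_inv, ← perm_mul, perm_conj_var]
      simp
    have hle : a' (ρ i.succ) ≤ a' (ρ i.castSucc) := ha' _ _ hlt.le
      ⟨_, mul_mem (mul_mem hy (s_mem_parabolic hi)) (inv_mem hy), hconj⟩
    rw [ha'ρ, ha'ρ, Equiv.swap_apply_left, Equiv.swap_apply_right] at hle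
    have heq : a i.castSucc = a i.succ := le_antisymm hle (dominant_iff.1 ha i hi)
    refine ih hy ?_ (by omega)
    rw [← h, s, ← perm_mul, perm_conj_mono, perm_conj_mono]
    congr 1
    funext x
    rw [mul_inv_rev, Equiv.Perm.mul_apply, Equiv.swap_inv, Equiv.swap_apply_def]
    split_ifs with hx hx <;> simp [hx, heq]

end Dominant

section Labels

variable {K₁ K₂ : Finset (Fin r)}

/-- The double coset representative `w p` of a label `(w, p)`. -/
def Label.elt (x : Label K₂ K₁) : W r := perm x.1.1 * mono x.1.2

theorem Label.elt_right (x : Label K₂ K₁) : x.elt.right = x.1.1 := right_perm_mul_mono _ _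

theorem exists_label (d : W r) : ∃ x : Label K₂ K₁, d ∈ dcoset K₂ K₁ x.elt := by
  obtain ⟨w, hw, x, hx, y, hy, e⟩ := exists_shortest K₂ K₁ d.right
  obtain ⟨a, ha⟩ := exists_eq_perm_mul_mono d
  obtain ⟨ρ, rfl⟩ := exists_perm_of_mem hy
  obtain ⟨g, hg, p, hp, h⟩ := exists_dominant (meet K₁ K₂ w) fun i => a (ρ⁻¹ i)
  refine ⟨⟨(w, p), hw, hp⟩, x * (perm w * g⁻¹ * (perm w)⁻¹), mul_mem hx ?_, g * perm ρ,
    mul_mem (parabolic_mono (meet_subset _ _ _) hg) hy, ?_⟩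
  · exact parabolic_mono (conj_meet_subset _ _ _) (conj_mem_parabolic (inv_mem hg))
  · rw [← perm_conj_mono] at h
    change d = _ * (perm w * mono p) * _
    rw [ha, e, ← h]
    group

theorem Label.eq_of_mem [NeZero r] {x x' : Label K₂ K₁} (h : x'.elt ∈ dcoset K₂ K₁ x.elt) :
    x' = x := by
  have hright := perm_right_mem_dcoset h
  rw [elt_right, elt_right] at hright
  obtain ⟨⟨w, p⟩, hw, hp⟩ := x
  obtain ⟨⟨w', p'⟩, hw', hp'⟩ := x'
  obtain rfl : w' = w := shortest_unique hw hw' hright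
  obtain ⟨u, hu, y, hy, e⟩ := h
  change perm w' * mono p' = u * (perm w' * mono p) * y at e
  obtain ⟨σ, rfl⟩ := exists_perm_of_mem hy
  have hu_eq : u⁻¹ = perm w' * perm σ * (perm w')⁻¹ := by
    have := congrArg (fun z => perm z.right) e
    simp only [SemidirectProduct.mul_right, perm_mul, perm_right hu,
      perm_right hy] at this
    have h' : perm w' = u * perm w' * perm σ := this
    rw [eq_comm, mul_inv_eq_iff_eq_mul, eq_inv_mul_iff_mul_eq, ← mul_assoc, ← h']
  have hmeet : perm σ ∈ parabolic (meet K₁ K₂ w') := mem_parabolic_meet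
    (leftMin_of_shortest hw) (rightMin_of_shortest hw) hy (hu_eq ▸ inv_mem hu)
  obtain rfl : p = p' := by
    refine dominant_unique hp hp' (inv_mem hmeet) ?_
    rw [← mul_right_inj (perm w'), e, ← inv_inv u, hu_eq]
    group
  rfl

end Labels

end Combinatorics

section Cosets

variable {r : ℕ} {K J : Finset (Fin r)} {d u : W r}

theorem mem_dcoset_empty_right : u ∈ dcoset K ∅ d ↔ ∃ x ∈ parabolic K, u = x * d := by
  simp [dcoset, parabolic_empty]

theorem inv_mem_dcoset_inv_iff : u⁻¹ ∈ dcoset K J d ↔ u ∈ dcoset J K d⁻¹ := by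
  constructor
  · rintro ⟨x, hx, y, hy, e⟩
    exact ⟨y⁻¹, inv_mem hy, x⁻¹, inv_mem hx, by rw [← inv_inv u, e]; group⟩
  · rintro ⟨x, hx, y, hy, rfl⟩
    exact ⟨y⁻¹, inv_mem hy, x⁻¹, inv_mem hx, by group⟩

theorem dcoset_one_of_subset_left (h : J ⊆ K) : dcoset J K 1 = parabolic K := by
  ext u
  constructor
  · rintro ⟨x, hx, y, hy, rfl⟩
    exact mul_mem (mul_mem (parabolic_mono h hx) (one_mem _)) hy
  · exact fun hu => ⟨1, one_mem _, u, hu, by simp⟩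

theorem dcoset_one_of_subset_right (h : J ⊆ K) : dcoset K J 1 = parabolic K := by
  ext u
  constructor
  · rintro ⟨x, hx, y, hy, rfl⟩
    exact mul_mem (mul_mem hx (one_mem _)) (parabolic_mono h hy)
  · exact fun hu => ⟨u, hu, 1, one_mem _, by simp⟩

theorem exists_dcoset_representative (K J : Finset (Fin r)) :
    ∃ f : W r → W r, (∀ u, f u ∈ dcoset K J u) ∧ ∀ d, ∀ u ∈ dcoset K J d, f u = f d := by
  refine ⟨fun u => Set.Nonempty.some ⟨u, mem_dcoset_self K J u⟩, fun u => Set.Nonempty.some_mem _,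
    fun d u hu => ?_⟩
  simp only [dcoset_eq hu]

theorem LeftMin.eq_of_mem [NeZero r] (hd : LeftMin K d) (hu : LeftMin K u)
    (h : u ∈ dcoset K ∅ d) : u = d := by
  obtain ⟨x, hx, rfl⟩ := mem_dcoset_empty_right.1 h
  have hle := hu x⁻¹ (inv_mem hx)
  rw [inv_mul_cancel_left, hd.len_mul hx] at hle
  rw [eq_one_of_len_eq_zero hx (by omega), one_mul]

end Cosets

section Coefficients

variable {k : Type*} [Field k] {q : k} {r : ℕ}

theorem dsum_congr {K J K' J' : Finset (Fin r)} {d d' : W r} (h : dcoset K J d = dcoset K' J' d') :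
    dsum q K J d = dsum q K' J' d' := by
  simp only [dsum, h]

theorem dsum_eq_v {K J L : Finset (Fin r)} {d : W r} (h : dcoset K J d = parabolic L) :
    dsum q K J d = v q L := by
  simp only [dsum, v, h]

variable [NeZero r]

/-- The coefficient of `T_w` in an element of the Hecke algebra. -/
noncomputable def coef (w : W r) : Hecke q r →ₗ[k] k :=
  (basisT q r).coord w

theorem ext_coef {h h' : Hecke q r} (e : ∀ w, coef w h = coef w h') : h = h' :=
  (basisT q r).ext_elem e

theorem linearMap_ext_T {M : Type*} [AddCommGroup M] [Module k M] {f g : Hecke q r →ₗ[k] M}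
    (hfg : ∀ w, f (T q w) = g (T q w)) : f = g :=
  (basisT q r).ext fun w => by rw [basisT_apply, hfg]

theorem coef_ne_zero_iff {w : W r} {h : Hecke q r} :
    coef w h ≠ 0 ↔ w ∈ ((basisT q r).repr h).support :=
  Finsupp.mem_support_iff.symm

theorem mem_span_T_image_iff {S : Set (W r)} {h : Hecke q r} :
    h ∈ Submodule.span k (T q '' S) ↔ ∀ w, coef w h ≠ 0 → w ∈ S := by
  rw [← funext (basisT_apply q (r := r)), Module.Basis.mem_span_image]
  exact forall_congr' fun w => by rw [coef_ne_zero_iff, Finset.mem_coe]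

open Classical in
theorem coef_T (w y : W r) : coef w (T q y) = if y = w then 1 else 0 := by
  rw [coef, Module.Basis.coord_apply, repr_T, Finsupp.single_apply]

open Classical in
theorem coef_dsum (K J : Finset (Fin r)) (d w : W r) :
    coef w (dsum q K J d) = if w ∈ dcoset K J d then 1 else 0 := by
  simp [dsum, coef_T]

open Classical in
theorem coef_sAff_mul (i : Fin (r + 1)) (w : W r) (h : Hecke q r) :
    coef w (T q (sAff i) * h) = if len w < len (sAff i * w) then q * coef (sAff i * w) h
      else coef (sAff i * w) h + (q - 1) * coef w h := by
  suffices hT : coef w ∘ₗ LinearMap.mulLeft k (T q (sAff i)) =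
      if len w < len (sAff i * w) then q • coef (sAff i * w)
      else coef (sAff i * w) + (q - 1) • coef w by
    refine (LinearMap.congr_fun hT h).trans ?_
    split_ifs <;> rfl
  refine linearMap_ext_T fun y => ?_
  have hlen := len_sAff_mul w i
  have hne : sAff i * w ≠ w := fun h => by rw [h] at hlen; omega
  have hy : sAff i * y = w ↔ y = sAff i * w :=
    ⟨by rintro rfl; simp, by rintro rfl; simp⟩
  rw [LinearMap.comp_apply, LinearMap.mulLeft_apply]
  by_cases hlt : len y < len (sAff i * y)
  · rw [T_sAff_mul_of_lt q hlt, coef_T, if_congr hy rfl rfl]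
    split_ifs with h₁ h₂ h₂
    · subst h₁
      rw [sAff_mul_cancel_left] at hlt
      omega
    · simp [coef_T, h₁, hne]
    · simp [coef_T, h₁]
    · simp [coef_T, h₁, show y ≠ w by rintro rfl; exact h₂ hlt]
  · rw [T_sAff_mul_of_not_lt q hlt, map_add, map_smul, map_smul, coef_T, coef_T,
      if_congr hy rfl rfl]
    split_ifs with h₁ h₂ h₃ h₃ h₂ h₃ h₃
    · exact absurd (h₁ ▸ h₂) hne
    · exact absurd (h₁ ▸ h₂) hne
    · simp [coef_T, h₁]
    · subst h₁
      rw [sAff_mul_cancel_left] at hlt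
      omega
    · exact absurd (h₂ ▸ h₃) hlt
    · simp [coef_T, h₂, hne.symm]
    · simp [coef_T, h₁]
    · simp [coef_T, h₁, h₂]

end Coefficients

section Reversal

variable {k : Type*} [Field k] {q : k} {r : ℕ} [NeZero r]

variable (q r) in
/-- The anti-automorphism `T_w ↦ T_{w⁻¹}`, as a homomorphism to the opposite algebra. -/
noncomputable def revHom : Hecke q r →ₐ[k] (Hecke q r)ᵐᵒᵖ :=
  RingQuot.liftAlgHom k ⟨FreeAlgebra.lift k fun w => MulOpposite.op (T q w⁻¹), fun _ _ h => by
    induction h with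
    | one => rw [FreeAlgebra.lift_ι_apply, map_one, inv_one, T_one, MulOpposite.op_one]
    | mul x y h =>
      rw [map_mul, FreeAlgebra.lift_ι_apply, FreeAlgebra.lift_ι_apply, FreeAlgebra.lift_ι_apply,
        ← MulOpposite.op_mul, T_mul, mul_inv_rev]
      rw [← mul_inv_rev, len_inv, len_inv, len_inv, h, add_comm]
    | quad i =>
      simp only [map_mul, map_sub, map_add, map_zero, map_one, FreeAlgebra.lift_ι_apply,
        AlgHom.commutes, sAff_inv, MulOpposite.algebraMap_apply]
      refine MulOpposite.unop_injective ?_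
      simp only [MulOpposite.unop_mul, MulOpposite.unop_sub, MulOpposite.unop_add,
        MulOpposite.unop_op, MulOpposite.unop_one, MulOpposite.unop_zero,
        Algebra.algebraMap_eq_smul_one]
      rw [add_mul, mul_sub, T_sAff_mul_self, mul_smul_comm, mul_one, one_mul]
      module⟩

theorem revHom_T (w : W r) : revHom q r (T q w) = MulOpposite.op (T q w⁻¹) :=
  (RingQuot.liftAlgHom_mkAlgHom_apply k _ _ _).trans (FreeAlgebra.lift_ι_apply _ _)

/-- The anti-automorphism `T_w ↦ T_{w⁻¹}`, as a linear map. It exchanges left and right cosets. -/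
noncomputable def rev : Hecke q r →ₗ[k] Hecke q r :=
  (MulOpposite.opLinearEquiv k).symm.toLinearMap ∘ₗ (revHom q r).toLinearMap

theorem rev_T (w : W r) : rev (T q w) = T q w⁻¹ := by
  simp [rev, revHom_T]

theorem rev_mul (a b : Hecke q r) : rev (a * b) = rev b * rev a := by
  simp [rev]

theorem rev_rev (a : Hecke q r) : rev (rev a) = a :=
  LinearMap.congr_fun (f := rev ∘ₗ rev) (g := LinearMap.id)
    (linearMap_ext_T fun w => by simp [rev_T]) a

theorem rev_injective : Function.Injective (rev (q := q) (r := r)) :=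
  Function.LeftInverse.injective rev_rev

theorem coef_rev (w : W r) (a : Hecke q r) : coef w (rev a) = coef w⁻¹ a := by
  classical
  exact LinearMap.congr_fun (f := coef w ∘ₗ rev) (g := coef w⁻¹)
    (linearMap_ext_T fun y => by simp [rev_T, coef_T, inv_eq_iff_eq_inv]) a

theorem rev_dsum (K J : Finset (Fin r)) (d : W r) : rev (dsum q K J d) = dsum q J K d⁻¹ := by
  classical
  refine ext_coef fun w => ?_
  rw [coef_rev, coef_dsum, coef_dsum, if_congr inv_mem_dcoset_inv_iff rfl rfl]

theorem rev_v (K : Finset (Fin r)) : rev (v q K) = v q K := by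
  rw [← dsum_eq_v (dcoset_one_of_subset_left subset_rfl), rev_dsum, inv_one]

end Reversal

section Constancy

variable {k : Type*} [Field k] {q : k} {r : ℕ} {K J : Finset (Fin r)} {h h' : Hecke q r}

/-- Elements with `T_s h = q h` for all `s` in `K`; their coefficients are constant on the cosets
`W_K w`. -/
def LeftConst (K : Finset (Fin r)) (h : Hecke q r) : Prop := ∀ i ∈ K, T q (s i) * h = q • h

/-- Elements with `h T_s = q h` for all `s` in `K`; their coefficients are constant on the cosets
`w W_K`. -/
def RightConst (K : Finset (Fin r)) (h : Hecke q r) : Prop := ∀ i ∈ K, h * T q (s i) = q • h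

theorem LeftConst.mul (H : LeftConst K h) (a : Hecke q r) : LeftConst K (h * a) := fun i hi => by
  rw [← mul_assoc, H i hi, smul_mul_assoc]

theorem LeftConst.sub (H : LeftConst K h) (H' : LeftConst K h') : LeftConst K (h - h') :=
  fun i hi => by rw [mul_sub, H i hi, H' i hi, smul_sub]

theorem LeftConst.smul (H : LeftConst K h) (c : k) : LeftConst K (c • h) := fun i hi => by
  rw [mul_smul_comm, H i hi, smul_comm]

variable [NeZero r]

theorem rightConst_iff : RightConst K h ↔ LeftConst K (rev h) := by
  refine forall₂_congr fun i _ => ?_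
  rw [← rev_injective.eq_iff, rev_mul, rev_T, s_inv, map_smul]

theorem RightConst.sub (H : RightConst K h) (H' : RightConst K h') : RightConst K (h - h') := by
  rw [rightConst_iff, map_sub]
  exact (rightConst_iff.1 H).sub (rightConst_iff.1 H')

theorem RightConst.smul (H : RightConst K h) (c : k) : RightConst K (c • h) := by
  rw [rightConst_iff, map_smul]
  exact (rightConst_iff.1 H).smul c

theorem coef_s_mul_eq {i : Fin r} (H : T q (s i) * h = q • h) (w : W r) :
    coef (s i * w) h = coef w h := by
  have hcoef := fun z => congrArg (coef z) H
  simp only [← sAff_succ, coef_sAff_mul, map_smul, smul_eq_mul] at hcoef ⊢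
  by_cases hlt : len w < len (sAff i.succ * w)
  · have := hcoef (sAff i.succ * w)
    rw [sAff_mul_cancel_left, if_neg hlt.not_gt] at this
    linear_combination -this
  · have := hcoef w
    rw [if_neg hlt] at this
    linear_combination this

theorem leftConst_iff : LeftConst K h ↔ ∀ x ∈ parabolic K, ∀ w, coef (x * w) h = coef w h := by
  constructor
  · intro H x hx
    induction hx using Subgroup.closure_induction with
    | mem x hx =>
      obtain ⟨i, hi, rfl⟩ := hx
      exact coef_s_mul_eq (H i hi)
    | one => exact fun w => by rw [one_mul]
    | mul x y _ _ hx hy => exact fun w => by rw [mul_assoc, hx, hy]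
    | inv x _ hx => exact fun w => by rw [← hx, mul_inv_cancel_left]
  · intro H i hi
    refine ext_coef fun w => ?_
    rw [← sAff_succ, coef_sAff_mul, map_smul, smul_eq_mul, sAff_succ, H _ (s_mem_parabolic hi)]
    split_ifs
    · rfl
    · ring

theorem leftConst_dsum (K J : Finset (Fin r)) (d : W r) : LeftConst K (dsum q K J d) := by
  classical
  exact leftConst_iff.2 fun x hx w => by
    rw [coef_dsum, coef_dsum, if_congr (mul_left_mem_dcoset_iff hx) rfl rfl]

theorem rightConst_dsum (K J : Finset (Fin r)) (d : W r) : RightConst J (dsum q K J d) := by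
  rw [rightConst_iff, rev_dsum]
  exact leftConst_dsum J K d⁻¹

theorem leftConst_v (h : J ⊆ K) : LeftConst J (v q K) := by
  rw [← dsum_eq_v (dcoset_one_of_subset_left h)]
  exact leftConst_dsum J K 1

theorem rightConst_v (K : Finset (Fin r)) : RightConst K (v q K) := by
  rw [rightConst_iff, rev_v]
  exact leftConst_v subset_rfl

theorem coef_eq_of_mem_dcoset (hK : LeftConst K h) (hJ : RightConst J h) {d u : W r}
    (hu : u ∈ dcoset K J d) : coef u h = coef d h := by
  obtain ⟨x, hx, y, hy, rfl⟩ := hu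
  rw [mul_assoc, leftConst_iff.1 hK x hx]
  simpa [coef_rev] using leftConst_iff.1 (rightConst_iff.1 hJ) y⁻¹ (inv_mem hy) d⁻¹

theorem eq_smul_dsum_of_forall_mem {d : W r} (hK : LeftConst K h) (hJ : RightConst J h)
    (hd : ∀ z, coef z h ≠ 0 → z ∈ dcoset K J d) : h = coef d h • dsum q K J d := by
  classical
  refine ext_coef fun z => ?_
  rw [map_smul, coef_dsum, smul_eq_mul]
  split_ifs with hz
  · rw [mul_one, coef_eq_of_mem_dcoset hK hJ hz]
  · rw [mul_zero, not_not.1 (mt (hd z) hz)]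

theorem mem_span_dsum (hK : LeftConst K h) (hJ : RightConst J h) :
    h ∈ Submodule.span k (dsum q K J '' {d | coef d h ≠ 0}) := by
  classical
  obtain ⟨f, hf, hf_eq⟩ := exists_dcoset_representative K J
  have hcoef (u : W r) : coef (f u) h = coef u h := coef_eq_of_mem_dcoset hK hJ (hf u)
  have hsum : h = ∑ d ∈ ((basisT q r).repr h).support.image f, coef d h • dsum q K J d := by
    refine ext_coef fun z => ?_
    simp only [map_sum, map_smul, coef_dsum, smul_eq_mul]
    rw [Finset.sum_eq_single (f z), if_pos (mem_dcoset_symm (hf z)), mul_one, hcoef]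
    · intro d hd hne
      obtain ⟨u, -, rfl⟩ := Finset.mem_image.1 hd
      rw [if_neg, mul_zero]
      exact fun hz => hne (by rw [hf_eq _ _ hz, hf_eq _ _ (hf u)])
    · intro hz
      rw [hcoef, not_not.1 (mt coef_ne_zero_iff.1 fun hs => hz (Finset.mem_image_of_mem f hs)),
        zero_mul]
  rw [hsum]
  refine Submodule.sum_mem _ fun d hd => Submodule.smul_mem _ _ (Submodule.subset_span ⟨d, ?_, rfl⟩)
  obtain ⟨u, hu, rfl⟩ := Finset.mem_image.1 hd
  rw [← hsum, Set.mem_ofPred_eq, hcoef]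
  exact coef_ne_zero_iff.2 hu

end Constancy

section CosetProducts

variable {k : Type*} [Field k] {q : k} {r : ℕ} [NeZero r] {K : Finset (Fin r)}

theorem T_s_mul_T {i : Fin r} {y : W r} (h : len (s i * y) = len y + 1) :
    T q (s i * y) = T q (s i) * T q y := by
  rw [T_mul q (by rw [h, len_s, add_comm])]

theorem v_mul_T_of_leftMin {g : W r} (hg : LeftMin K g) : v q K * T q g = dsum q K ∅ g := by
  rw [v, Finset.sum_mul, dsum]
  refine Finset.sum_nbij (· * g) (fun x hx => ?_) (mul_left_injective g).injOn (fun u hu => ?_)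
    fun x hx => T_mul q (hg.len_mul ((Set.Finite.mem_toFinset _).1 hx))
  · rw [Set.Finite.mem_toFinset] at hx ⊢
    exact mem_dcoset_empty_right.2 ⟨x, hx, rfl⟩
  · rw [Set.Finite.coe_toFinset] at hu ⊢
    obtain ⟨x, hx, rfl⟩ := mem_dcoset_empty_right.1 hu
    exact ⟨x, hx, rfl⟩

theorem v_mul_T_of_mem {x : W r} (hx : x ∈ parabolic K) : v q K * T q x = q ^ len x • v q K := by
  induction hn : len x generalizing x with
  | zero => rw [eq_one_of_len_eq_zero hx hn, T_one, mul_one, pow_zero, one_smul]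
  | succ n ih =>
    obtain ⟨i, hi, y, hy, rfl, hlen⟩ := exists_parabolic_left_descent hx
      (by rintro rfl; simp [len_one] at hn)
    rw [T_s_mul_T hlen, ← mul_assoc, rightConst_v K i hi, smul_mul_assoc, ih hy (by omega),
      smul_smul, pow_succ']

theorem exists_v_mul_T_eq (K : Finset (Fin r)) (g : W r) :
    ∃ a : ℕ, v q K * T q g = q ^ a • dsum q K ∅ g := by
  obtain ⟨x, hx, hmin⟩ := exists_leftMin K g
  have hT : T q g = T q x⁻¹ * T q (x * g) := by
    rw [T_mul q (hmin.len_mul (inv_mem hx)), inv_mul_cancel_left]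
  refine ⟨len x⁻¹, ?_⟩
  rw [hT, ← mul_assoc, v_mul_T_of_mem (inv_mem hx), smul_mul_assoc, v_mul_T_of_leftMin hmin,
    dsum_congr (dcoset_eq (mem_dcoset_empty_right.2 ⟨x, hx, rfl⟩))]

open Classical in
/-- The part of an element supported on minimal representatives of the cosets `W_K w`. For an
element which is constant on these cosets it is the cofactor of `v_K`. -/
noncomputable def leftPart (K : Finset (Fin r)) (h : Hecke q r) : Hecke q r :=
  ∑ g ∈ ((basisT q r).repr h).support.filter (LeftMin K), coef g h • T q g

theorem LeftConst.v_mul_leftPart {h : Hecke q r} (H : LeftConst K h) :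
    v q K * leftPart K h = h := by
  classical
  refine ext_coef fun z => ?_
  obtain ⟨x, hx, hmin⟩ := exists_leftMin K z
  have hcoef : coef (x * z) h = coef z h := leftConst_iff.1 H x hx z
  rw [leftPart, Finset.mul_sum, map_sum, Finset.sum_eq_single (x * z)]
  · rw [mul_smul_comm, v_mul_T_of_leftMin hmin, map_smul, coef_dsum, if_pos, smul_eq_mul, mul_one,
      hcoef]
    exact mem_dcoset_empty_right.2 ⟨x⁻¹, inv_mem hx, by rw [inv_mul_cancel_left]⟩
  · intro g hg hne
    have hg_min := (Finset.mem_filter.1 hg).2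
    rw [mul_smul_comm, v_mul_T_of_leftMin hg_min, map_smul, coef_dsum, if_neg, smul_zero]
    exact fun hz => hne (hg_min.eq_of_mem hmin ((mul_left_mem_dcoset_iff hx).2 hz)).symm
  · intro hnot
    have hzero : coef (x * z) h = 0 :=
      not_not.1 (mt coef_ne_zero_iff.1 fun hs => hnot (Finset.mem_filter.2 ⟨hs, hmin⟩))
    rw [hzero, zero_smul, mul_zero, map_zero]

theorem RightConst.exists_eq_mul {h : Hecke q r} (H : RightConst K h) : ∃ a, h = a * v q K :=
  ⟨rev (leftPart K (rev h)), rev_injective (by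
    rw [rev_mul, rev_rev, rev_v, (rightConst_iff.1 H).v_mul_leftPart])⟩

open Classical in
theorem leftPart_dsum (K J : Finset (Fin r)) (d : W r) : leftPart K (dsum q K J d) =
    ∑ g ∈ (dcoset_finite K J d).toFinset.filter (LeftMin K), T q g := by
  have hsupp : ((basisT q r).repr (dsum q K J d)).support = (dcoset_finite K J d).toFinset := by
    ext g
    rw [← coef_ne_zero_iff, coef_dsum, Set.Finite.mem_toFinset]
    simp
  rw [leftPart, hsupp]
  refine Finset.sum_congr rfl fun g hg => ?_
  rw [coef_dsum, if_pos ((Set.Finite.mem_toFinset _).1 (Finset.mem_filter.1 hg).1), one_smul]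

end CosetProducts

section LeadingTerms

variable {k : Type*} [Field k] (q : k) {r : ℕ}

/-- The span of the `T_{u g}` with `u` in `W_K` of length less than `n`. These are the error terms
in a product `T_x T_g` with `x` in `W_K` of length `n`. -/
noncomputable def shorterSpan (K : Finset (Fin r)) (g : W r) (n : ℕ) : Submodule k (Hecke q r) :=
  Submodule.span k ((fun u => T q (u * g)) '' {u | u ∈ parabolic K ∧ len u < n})

variable {q} {K : Finset (Fin r)} {g : W r} {n : ℕ}

theorem T_mul_mem_shorterSpan {u : W r} (hu : u ∈ parabolic K) (hlen : len u < n) :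
    T q (u * g) ∈ shorterSpan q K g n :=
  Submodule.subset_span ⟨u, ⟨hu, hlen⟩, rfl⟩

variable [NeZero r]

theorem exists_T_s_mul_T_eq (i : Fin r) (y : W r) :
    ∃ (a : ℕ) (c : k), T q (s i) * T q y = q ^ a • T q (s i * y) + c • T q y := by
  rw [← sAff_succ]
  by_cases hlt : len y < len (sAff i.succ * y)
  · exact ⟨0, 0, by rw [T_sAff_mul_of_lt q hlt, pow_zero, one_smul, zero_smul, add_zero]⟩
  · exact ⟨1, q - 1, by rw [T_sAff_mul_of_not_lt q hlt, pow_one]⟩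

theorem T_s_mul_mem_shorterSpan {i : Fin r} (hi : i ∈ K) {z : Hecke q r}
    (hz : z ∈ shorterSpan q K g n) : T q (s i) * z ∈ shorterSpan q K g (n + 1) := by
  refine (Submodule.span_le (p := (shorterSpan q K g (n + 1)).comap
    (LinearMap.mulLeft k (T q (s i))))).2 ?_ hz
  rintro _ ⟨u, ⟨hu, hlt⟩, rfl⟩
  obtain ⟨a, c, h⟩ := exists_T_s_mul_T_eq (q := q) i (u * g)
  have hlen := len_sAff_mul u i.succ
  rw [sAff_succ] at hlen
  rw [SetLike.mem_coe, Submodule.mem_comap, LinearMap.mulLeft_apply, h, ← mul_assoc]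
  exact add_mem
    (Submodule.smul_mem _ _ (T_mul_mem_shorterSpan (mul_mem (s_mem_parabolic hi) hu) (by omega)))
    (Submodule.smul_mem _ _ (T_mul_mem_shorterSpan hu (by omega)))

theorem exists_T_mul_T_sub_mem {x : W r} (hx : x ∈ parabolic K) (g : W r) :
    ∃ a : ℕ, T q x * T q g - q ^ a • T q (x * g) ∈ shorterSpan q K g (len x) := by
  induction hn : len x generalizing x with
  | zero =>
    refine ⟨0, ?_⟩
    rw [eq_one_of_len_eq_zero hx hn, T_one, one_mul, one_mul, pow_zero, one_smul, sub_self]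
    exact zero_mem _
  | succ n ih =>
    obtain ⟨i, hi, y, hy, rfl, hlen⟩ := exists_parabolic_left_descent hx
      (by rintro rfl; simp [len_one] at hn)
    obtain ⟨a, ha⟩ := ih hy (by omega)
    obtain ⟨b, c, hb⟩ := exists_T_s_mul_T_eq (q := q) i (y * g)
    refine ⟨a + b, ?_⟩
    have hsum := add_mem (T_s_mul_mem_shorterSpan hi ha) (Submodule.smul_mem _ (q ^ a * c)
      (T_mul_mem_shorterSpan hy (show len y < n + 1 by omega)))
    rw [mul_sub, mul_smul_comm, hb, ← mul_assoc, ← T_s_mul_T hlen, ← mul_assoc] at hsum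
    convert hsum using 1
    rw [pow_add]
    module

end LeadingTerms

section Triangularity

variable {r : ℕ}

theorem perm_mem_parabolic_univ (σ : Equiv.Perm (Fin (r + 1))) :
    perm σ ∈ parabolic (Finset.univ : Finset (Fin r)) := by
  have h : σ ∈ Submonoid.closure (Set.range fun i : Fin r => Equiv.swap i.castSucc i.succ) :=
    Equiv.Perm.mclosure_swap_castSucc_succ r ▸ Submonoid.mem_top σ
  induction h using Submonoid.closure_induction with
  | mem x hx =>
    obtain ⟨i, rfl⟩ := hx
    exact s_mem_parabolic (Finset.mem_univ i)
  | one => exact one_mem _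
  | mul x y _ _ hx hy =>
    rw [perm_mul]
    exact mul_mem hx hy

/-- The elements lying over a double coset `W_{K₂} σ W_{K₁}` in the symmetric group that contains
an element of length less than `n`. They carry the error terms in the triangularity of the
proposed basis. -/
def lowerCosets (K₂ K₁ : Finset (Fin r)) (n : ℕ) : Set (W r) :=
  {z | ∃ σ, len (perm σ) < n ∧ perm z.right ∈ dcoset K₂ K₁ (perm σ)}

variable {K₁ K₂ J : Finset (Fin r)} {w : Equiv.Perm (Fin (r + 1))} {p : Fin (r + 1) → ℤ}

theorem notMem_lowerCosets {z : W r} (hw : w ∈ shortest K₂ K₁)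
    (hz : perm z.right ∈ dcoset K₂ K₁ (perm w)) : z ∉ lowerCosets K₂ K₁ (len (perm w)) := by
  rintro ⟨σ, hlt, hσ⟩
  refine (hw (perm σ) ?_).not_gt hlt
  rw [← dcoset_eq hz]
  exact mem_dcoset_symm hσ

theorem perm_right_mem_parabolic_of_mem_dcoset {g : W r} (hg : g ∈ dcoset J K₁ (mono p))
    (hJ : J ⊆ K₁) : perm g.right ∈ parabolic K₁ := by
  obtain ⟨x, hx, y, hy, rfl⟩ := hg
  have h : perm (x * mono p * y).right = perm x.right * perm y.right := by
    rw [← perm_mul]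
    simp [mono]
  rw [h, perm_right hx, perm_right hy]
  exact mul_mem (parabolic_mono hJ hx) hy

theorem mem_lowerCosets_of_mem_dcoset {n : ℕ} (hJ : J ⊆ K₁) {g : W r}
    (hg : g ∈ dcoset J K₁ (mono p)) {σ : Equiv.Perm (Fin (r + 1))} (hσ : len (perm σ) < n)
    {z : W r} (hz : z ∈ dcoset K₂ ∅ (perm σ * g)) : z ∈ lowerCosets K₂ K₁ n := by
  obtain ⟨x, hx, rfl⟩ := mem_dcoset_empty_right.1 hz
  refine ⟨σ, hσ, x, hx, perm g.right, perm_right_mem_parabolic_of_mem_dcoset hg hJ, ?_⟩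
  rw [SemidirectProduct.mul_right, SemidirectProduct.mul_right, perm_mul, perm_mul, perm_right hx,
    mul_assoc]
  rfl

theorem mem_dcoset_of_mem_dcoset_meet {g z : W r}
    (hg : g ∈ dcoset (meet K₁ K₂ w) K₁ (mono p)) (hz : z ∈ dcoset K₂ ∅ (perm w * g)) :
    z ∈ dcoset K₂ K₁ (perm w * mono p) := by
  obtain ⟨u, hu, rfl⟩ := mem_dcoset_empty_right.1 hz
  obtain ⟨x, hx, y, hy, rfl⟩ := hg
  have hconj := parabolic_mono (conj_meet_subset K₁ K₂ w) (conj_mem_parabolic hx)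
  exact ⟨u * (perm w * x * (perm w)⁻¹), mul_mem hu hconj, y, hy, by group⟩

theorem perm_mul_mono_mem_dcoset {y : W r} (hy : y ∈ parabolic (meet K₁ K₂ w)) :
    perm w * mono p ∈ dcoset K₂ ∅ (perm w * (y * mono p)) := by
  have hconj := parabolic_mono (conj_meet_subset K₁ K₂ w) (conj_mem_parabolic (inv_mem hy))
  exact mem_dcoset_empty_right.2 ⟨_, hconj, by group⟩

variable [NeZero r]

theorem mem_dcoset_empty_of_perm_mul_mono_mem (hw : w ∈ shortest K₂ K₁) {g : W r}
    (hg : g ∈ dcoset (meet K₁ K₂ w) K₁ (mono p))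
    (hwp : perm w * mono p ∈ dcoset K₂ ∅ (perm w * g)) :
    g ∈ dcoset (meet K₁ K₂ w) ∅ (mono p) := by
  obtain ⟨u, hu, e⟩ := mem_dcoset_empty_right.1 hwp
  have hright : perm w = u * (perm w * perm g.right) := by
    have h := congrArg (fun z : W r => perm z.right) e
    simp only [SemidirectProduct.mul_right, perm_mul, perm_right hu] at h
    exact h
  have hconj : perm w * perm g.right * (perm w)⁻¹ = u⁻¹ := by
    refine eq_inv_of_mul_eq_one_right ?_
    rw [← mul_assoc, ← hright, mul_inv_cancel]
  have hmem := mem_parabolic_meet (leftMin_of_shortest hw) (rightMin_of_shortest hw)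
    (perm_right_mem_parabolic_of_mem_dcoset hg (meet_subset K₁ K₂ w)) (hconj ▸ inv_mem hu)
  refine mem_dcoset_empty_right.2 ⟨_, hmem, mul_left_cancel (a := u * perm w) ?_⟩
  rw [mul_assoc, ← e]
  nth_rw 1 [hright]
  group

variable {k : Type*} [Field k] {q : k}

theorem exists_v_mul_T_mul_T_sub_mem (hJ : J ⊆ K₁) (K₂ : Finset (Fin r))
    (w : Equiv.Perm (Fin (r + 1))) {g : W r} (hg : g ∈ dcoset J K₁ (mono p)) :
    ∃ a : ℕ, v q K₂ * (T q (perm w) * T q g) - q ^ a • dsum q K₂ ∅ (perm w * g) ∈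
      Submodule.span k (T q '' lowerCosets K₂ K₁ (len (perm w))) := by
  classical
  obtain ⟨a, ha⟩ := exists_T_mul_T_sub_mem (q := q) (perm_mem_parabolic_univ w) g
  obtain ⟨b, hb⟩ := exists_v_mul_T_eq (q := q) K₂ (perm w * g)
  have hle : shorterSpan q Finset.univ g (len (perm w)) ≤
      (Submodule.span k (T q '' lowerCosets K₂ K₁ (len (perm w)))).comap
        (LinearMap.mulLeft k (v q K₂)) := by
    refine Submodule.span_le.2 ?_
    rintro _ ⟨u, ⟨hu, hlt⟩, rfl⟩
    obtain ⟨σ, rfl⟩ := exists_perm_of_mem hu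
    obtain ⟨c, hc⟩ := exists_v_mul_T_eq (q := q) K₂ (perm σ * g)
    rw [SetLike.mem_coe, Submodule.mem_comap, LinearMap.mulLeft_apply, hc]
    refine Submodule.smul_mem _ _ (Submodule.sum_mem _ fun z hz =>
      Submodule.subset_span ⟨z, ?_, rfl⟩)
    exact mem_lowerCosets_of_mem_dcoset hJ hg hlt ((Set.Finite.mem_toFinset _).1 hz)
  have hmem := hle ha
  rw [Submodule.mem_comap, LinearMap.mulLeft_apply, mul_sub, mul_smul_comm, hb, smul_smul,
    ← pow_add] at hmem
  exact ⟨a + b, hmem⟩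

/-- The value at `v_{K₁}` of the product of the proposed basis with label `(w, p)`, up to a power
of `q`; see `exists_evalGen_basisElt_eq`. -/
noncomputable def leadingElt (q : k) (K₂ K₁ : Finset (Fin r)) (w : Equiv.Perm (Fin (r + 1)))
    (p : Fin (r + 1) → ℤ) : Hecke q r :=
  v q K₂ * (T q (perm w) *
    leftPart (meet K₁ K₂ w) (dsum q (meet K₁ K₂ w) K₁ (mono p)))

open Classical in
theorem exists_leadingElt_sub_sum_mem (K₂ K₁ : Finset (Fin r)) (w : Equiv.Perm (Fin (r + 1)))
    (p : Fin (r + 1) → ℤ) :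
    ∃ a : W r → ℕ, leadingElt q K₂ K₁ w p - ∑ g ∈ (dcoset_finite (meet K₁ K₂ w) K₁
        (mono p)).toFinset.filter (LeftMin (meet K₁ K₂ w)), q ^ a g • dsum q K₂ ∅ (perm w * g) ∈
      Submodule.span k (T q '' lowerCosets K₂ K₁ (len (perm w))) := by
  choose! a ha using fun g (hg : g ∈ dcoset (meet K₁ K₂ w) K₁ (mono p)) =>
    exists_v_mul_T_mul_T_sub_mem (q := q) (meet_subset K₁ K₂ w) K₂ w hg
  refine ⟨a, ?_⟩
  rw [leadingElt, leftPart_dsum, Finset.mul_sum, Finset.mul_sum, ← Finset.sum_sub_distrib]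
  exact Submodule.sum_mem _ fun g hg =>
    ha g ((Set.Finite.mem_toFinset _).1 (Finset.mem_filter.1 hg).1)

theorem mem_of_coef_leadingElt_ne_zero {z : W r} (hz : coef z (leadingElt q K₂ K₁ w p) ≠ 0) :
    z ∈ dcoset K₂ K₁ (perm w * mono p) ∨ z ∈ lowerCosets K₂ K₁ (len (perm w)) := by
  classical
  obtain ⟨a, ha⟩ := exists_leadingElt_sub_sum_mem (q := q) K₂ K₁ w p
  refine (mem_span_T_image_iff
    (S := dcoset K₂ K₁ (perm w * mono p) ∪ lowerCosets K₂ K₁ (len (perm w)))).1 ?_ z hz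
  rw [← sub_add_cancel (leadingElt q K₂ K₁ w p)]
  refine add_mem (Submodule.span_mono (Set.image_mono Set.subset_union_right) ha)
    (Submodule.sum_mem _ fun g hg => Submodule.smul_mem _ _ (Submodule.sum_mem _ fun u hu =>
      Submodule.subset_span ⟨u, Or.inl ?_, rfl⟩))
  exact mem_dcoset_of_mem_dcoset_meet ((Set.Finite.mem_toFinset _).1 (Finset.mem_filter.1 hg).1)
    ((Set.Finite.mem_toFinset _).1 hu)

theorem exists_coef_leadingElt_eq (hw : w ∈ shortest K₂ K₁) (p : Fin (r + 1) → ℤ) :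
    ∃ a : ℕ, coef (perm w * mono p) (leadingElt q K₂ K₁ w p) = q ^ a := by
  classical
  obtain ⟨a, ha⟩ := exists_leadingElt_sub_sum_mem (q := q) K₂ K₁ w p
  obtain ⟨y, hy, hmin⟩ := exists_leftMin (meet K₁ K₂ w) (mono p)
  have hcoef := not_not.1 (mt (mem_span_T_image_iff.1 ha (perm w * mono p))
    (notMem_lowerCosets hw (by rw [right_perm_mul_mono]; exact mem_dcoset_self _ _ _)))
  simp only [map_sub, map_sum, map_smul, coef_dsum, smul_eq_mul] at hcoef
  refine ⟨a (y * mono p), ?_⟩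
  rw [sub_eq_zero.1 hcoef, Finset.sum_eq_single (y * mono p), if_pos (perm_mul_mono_mem_dcoset hy),
    mul_one]
  · intro g hg hne
    obtain ⟨hg_mem, hg_min⟩ := Finset.mem_filter.1 hg
    rw [if_neg, mul_zero]
    intro hwp
    have hgp := mem_dcoset_empty_of_perm_mul_mono_mem hw ((Set.Finite.mem_toFinset _).1 hg_mem) hwp
    refine hne (hmin.eq_of_mem hg_min ?_)
    rwa [dcoset_eq (mem_dcoset_empty_right.2 ⟨y, hy, rfl⟩)]
  · refine fun h => absurd (Finset.mem_filter.2 ⟨(Set.Finite.mem_toFinset _).2 ?_, hmin⟩) h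
    exact ⟨y, hy, 1, one_mem _, (mul_one _).symm⟩

end Triangularity

section Homomorphisms

variable {k : Type*} [Field k] {q : k} {r : ℕ} {J K : Finset (Fin r)} {h : Hecke q r}

theorem mem_ideal_iff : h ∈ ideal q K ↔ ∃ a, h = v q K * a := by
  rw [ideal, Submodule.mem_span_singleton]
  exact ⟨fun ⟨a, ha⟩ => ⟨a.unop, ha.symm⟩, fun ⟨a, ha⟩ => ⟨MulOpposite.op a, ha.symm⟩⟩

theorem hom_apply (f : HomH q J K) {y : ideal q J} {a : Hecke q r}
    (hy : (y : Hecke q r) = v q J * a) : (f y : Hecke q r) = f (gen q J) * a := by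
  have hy' : y = MulOpposite.op a • gen q J := Subtype.ext hy
  rw [hy', map_smul]
  rfl

/-- Evaluation of a homomorphism at `v_J`, which embeds `Hom_H(v_J H, v_K H)` in the Hecke
algebra. -/
noncomputable def evalGen (q : k) {r : ℕ} (J K : Finset (Fin r)) : HomH q J K →ₗ[k] Hecke q r where
  toFun f := f (gen q J)
  map_add' _ _ := rfl
  map_smul' _ _ := rfl

theorem evalGen_injective (J K : Finset (Fin r)) : Function.Injective (evalGen q J K) :=
  fun _ _ h => hom_ext q (Subtype.ext h)

variable [NeZero r]

theorem leftConst_evalGen (f : HomH q J K) : LeftConst K (evalGen q J K f) := by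
  obtain ⟨a, ha⟩ := mem_ideal_iff.1 (f (gen q J)).2
  change LeftConst K (f (gen q J) : Hecke q r)
  rw [ha]
  exact (leftConst_v subset_rfl).mul a

theorem rightConst_evalGen (f : HomH q J K) : RightConst J (evalGen q J K f) := by
  intro i hi
  have hv : v q J * T q (s i) = v q J * q • 1 := by
    rw [rightConst_v J i hi, mul_smul_comm, mul_one]
  let y : ideal q J := ⟨_, mem_ideal_iff.2 ⟨T q (s i), rfl⟩⟩
  have hT : (f y : Hecke q r) = f (gen q J) * T q (s i) := hom_apply f rfl
  have hq : (f y : Hecke q r) = f (gen q J) * q • 1 := hom_apply f hv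
  rw [mul_smul_comm, mul_one] at hq
  exact hT.symm.trans hq

theorem exists_evalGen_eq (hK : LeftConst K h) (hJ : RightConst J h) :
    ∃ f : HomH q J K, evalGen q J K f = h := by
  obtain ⟨c, hc⟩ := hJ.exists_eq_mul
  let mulLeft : Hecke q r →ₗ[(Hecke q r)ᵐᵒᵖ] Hecke q r :=
    { toFun := fun x => c * x
      map_add' := mul_add c
      map_smul' := fun a x => (mul_assoc c x a.unop).symm }
  have hmem (x : ideal q J) : mulLeft x ∈ ideal q K := by
    obtain ⟨a, ha⟩ := mem_ideal_iff.1 x.2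
    change c * (x : Hecke q r) ∈ ideal q K
    rw [ha, ← mul_assoc, ← hc]
    exact mem_ideal_iff.2 ⟨_, (hK.mul a).v_mul_leftPart.symm⟩
  exact ⟨(mulLeft ∘ₗ (ideal q J).subtype).codRestrict _ hmem, hc.symm⟩

theorem b_gen (K J : Finset (Fin r)) (d : W r) :
    (b q K J d (gen q J) : Hecke q r) = dsum q K J d := by
  have hb : ∃ f : HomH q J K, (f (gen q J) : Hecke q r) = dsum q K J d :=
    exists_evalGen_eq (leftConst_dsum K J d) (rightConst_dsum K J d)
  rw [b, dif_pos hb]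
  exact hb.choose_spec

end Homomorphisms

section LeadingCoset

variable {r : ℕ} {J K : Finset (Fin r)}

theorem len_perm_one : len (perm (1 : Equiv.Perm (Fin (r + 1)))) = 0 := by
  rw [perm, map_one, len_one]

theorem one_mem_shortest (K J : Finset (Fin r)) : 1 ∈ shortest K J :=
  fun _ _ => len_perm_one.trans_le (Nat.zero_le _)

theorem meet_one (h : J ⊆ K) : meet J K 1 = J := by
  ext i
  rw [mem_meet_iff]
  exact ⟨And.left, fun hi => ⟨hi, i, h hi, by simp [perm]⟩⟩

theorem mono_neg (p : Fin (r + 1) → ℤ) : mono (-p) = (mono p)⁻¹ :=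
  map_inv SemidirectProduct.inl _

variable {k : Type*} [Field k] {q : k} [NeZero r] {K₁ K₂ : Finset (Fin r)}
  {w : Equiv.Perm (Fin (r + 1))}

theorem rev_dsum_mul (h : J ⊆ K) (p : Fin (r + 1) → ℤ) {m : Hecke q r} (hm : v q K = v q J * m) :
    rev (dsum q J J (mono p) * m) = leadingElt q K J 1 (-p) := by
  rw [rev_mul, rev_dsum, ← (leftConst_dsum J J _).v_mul_leftPart, ← mul_assoc, ← rev_v J, ← rev_mul,
    ← hm, rev_v, leadingElt, meet_one h, mono_neg, perm, map_one, T_one, one_mul]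

theorem exists_dsum_mul_eq (h : J ⊆ K) (p : Fin (r + 1) → ℤ) {m : Hecke q r}
    (hm : v q K = v q J * m) :
    ∃ a : ℕ, dsum q J J (mono p) * m = q ^ a • dsum q J K (mono p) := by
  obtain ⟨a, ha⟩ := exists_coef_leadingElt_eq (q := q) (one_mem_shortest K J) (-p)
  have hleft : LeftConst K (leadingElt q K J 1 (-p)) := (leftConst_v subset_rfl).mul _
  have hright : RightConst J (leadingElt q K J 1 (-p)) := by
    rw [rightConst_iff, ← rev_dsum_mul h p hm, rev_rev]
    exact (leftConst_dsum J J (mono p)).mul m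
  have hsupp (z : W r) (hz : coef z (leadingElt q K J 1 (-p)) ≠ 0) :
      z ∈ dcoset K J (perm 1 * mono (-p)) := by
    refine (mem_of_coef_leadingElt_ne_zero hz).resolve_right ?_
    rintro ⟨σ, hσ, -⟩
    rw [len_perm_one] at hσ
    exact Nat.not_lt_zero _ hσ
  refine ⟨a, rev_injective ?_⟩
  rw [rev_dsum_mul h p hm, eq_smul_dsum_of_forall_mem hleft hright hsupp, ha, map_smul, rev_dsum,
    ← mono_neg, perm, map_one, one_mul]

theorem dsum_conj_meet (hw : w ∈ shortest K₂ K₁) :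
    dsum q (conj w (meet K₁ K₂ w)) (meet K₁ K₂ w) (perm w) =
      v q (conj w (meet K₁ K₂ w)) * T q (perm w) := by
  rw [v_mul_T_of_leftMin fun x hx =>
    leftMin_of_shortest hw x (parabolic_mono (conj_meet_subset K₁ K₂ w) hx)]
  refine dsum_congr (Set.ext fun z => ⟨?_, fun hz => ?_⟩)
  · rintro ⟨x, hx, y, hy, rfl⟩
    exact mem_dcoset_empty_right.2 ⟨_, mul_mem hx (conj_mem_parabolic hy), by group⟩
  · obtain ⟨x, hx, rfl⟩ := mem_dcoset_empty_right.1 hz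
    exact ⟨x, hx, 1, one_mem _, (mul_one _).symm⟩

theorem exists_evalGen_basisElt_eq (x : Label K₂ K₁) : ∃ a : ℕ,
    evalGen q K₁ K₂ (basisElt q K₂ K₁ x) = q ^ a • leadingElt q K₂ K₁ x.1.1 x.1.2 := by
  obtain ⟨⟨w, p⟩, hw, -⟩ := x
  set J := meet K₁ K₂ w
  have hJ : J ⊆ K₁ := meet_subset K₁ K₂ w
  have hv : v q K₁ = v q J * leftPart J (v q K₁) := (leftConst_v hJ).v_mul_leftPart.symm
  obtain ⟨a, ha⟩ := exists_dsum_mul_eq hJ p hv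
  refine ⟨a, ?_⟩
  have h₁ : (b q J K₁ 1 (gen q K₁) : Hecke q r) = v q J * leftPart J (v q K₁) := by
    rw [b_gen, dsum_eq_v (dcoset_one_of_subset_left hJ), ← hv]
  have h₂ := hom_apply (b q J J (mono p)) h₁
  rw [b_gen, ha, ← (leftConst_dsum J K₁ _).v_mul_leftPart, ← mul_smul_comm] at h₂
  have h₃ := hom_apply (b q (conj w J) J (perm w)) h₂
  rw [b_gen, dsum_conj_meet hw, mul_assoc] at h₃
  have h₄ := hom_apply (b q K₂ (conj w J) 1) h₃
  rw [b_gen, dsum_eq_v (dcoset_one_of_subset_right (conj_meet_subset K₁ K₂ w)), mul_smul_comm,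
    mul_smul_comm] at h₄
  exact h₄

theorem exists_coef_evalGen_basisElt_eq (x : Label K₂ K₁) :
    ∃ a : ℕ, coef x.elt (evalGen q K₁ K₂ (basisElt q K₂ K₁ x)) = q ^ a := by
  obtain ⟨a, ha⟩ := exists_evalGen_basisElt_eq (q := q) x
  obtain ⟨c, hc⟩ := exists_coef_leadingElt_eq (q := q) x.2.1 x.1.2
  exact ⟨a + c, by rw [ha, map_smul, Label.elt, hc, smul_eq_mul, pow_add]⟩

theorem mem_of_coef_evalGen_basisElt_ne_zero (x : Label K₂ K₁) {z : W r}
    (hz : coef z (evalGen q K₁ K₂ (basisElt q K₂ K₁ x)) ≠ 0) :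
    z ∈ dcoset K₂ K₁ x.elt ∨ z ∈ lowerCosets K₂ K₁ (len (perm x.1.1)) := by
  obtain ⟨a, ha⟩ := exists_evalGen_basisElt_eq (q := q) x
  rw [ha, map_smul] at hz
  exact mem_of_coef_leadingElt_ne_zero (right_ne_zero_of_mul hz)

end LeadingCoset

section HomBasis

variable {k : Type*} [Field k] {q : k} {r : ℕ} [NeZero r]

theorem linearIndependent_basisElt (hq : q ≠ 0) (K₂ K₁ : Finset (Fin r)) :
    LinearIndependent k (basisElt q K₂ K₁) := by
  classical
  refine LinearIndependent.of_comp (evalGen q K₁ K₂) (linearIndependent_iff'.2 ?_)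
  intro t g hsum i hi
  by_contra hgi
  obtain ⟨x, hx, hmax⟩ := Finset.exists_max_image (t.filter (g · ≠ 0)) (fun y => len (perm y.1.1))
    ⟨i, Finset.mem_filter.2 ⟨hi, hgi⟩⟩
  obtain ⟨hxt, hgx⟩ := Finset.mem_filter.1 hx
  have hcoef := congrArg (coef x.elt) hsum
  rw [map_sum, map_zero, Finset.sum_eq_single_of_mem x hxt, map_smul, smul_eq_mul] at hcoef
  · obtain ⟨a, ha⟩ := exists_coef_evalGen_basisElt_eq (q := q) x
    exact mul_ne_zero hgx (pow_ne_zero a hq) (ha ▸ hcoef)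
  · intro y hy hne
    rw [map_smul, smul_eq_mul]
    by_contra hyx
    obtain ⟨hgy, hcy⟩ := mul_ne_zero_iff.1 hyx
    obtain hcoset | ⟨σ, hlt, hσ⟩ := mem_of_coef_evalGen_basisElt_ne_zero y hcy
    · exact hne (Label.eq_of_mem hcoset).symm
    · rw [Label.elt_right] at hσ
      have hle := x.2.1 _ (mem_dcoset_symm hσ)
      have hle' := hmax y (Finset.mem_filter.2 ⟨hy, hgy⟩)
      omega

theorem mem_of_forall_dsum_mem {K J : Finset (Fin r)} {M : Submodule k (Hecke q r)}
    {h : Hecke q r} (hK : LeftConst K h) (hJ : RightConst J h)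
    (hM : ∀ d, coef d h ≠ 0 → dsum q K J d ∈ M) : h ∈ M :=
  Submodule.span_le.2 (Set.image_subset_iff.2 hM) (mem_span_dsum hK hJ)

theorem Label.dsum_elt_mem (hq : q ≠ 0) {K₁ K₂ : Finset (Fin r)} (x : Label K₂ K₁) :
    dsum q K₂ K₁ x.elt ∈
      (Submodule.span k (Set.range (basisElt q K₂ K₁))).map (evalGen q K₁ K₂) := by
  classical
  induction hn : len (perm x.1.1) using Nat.strong_induction_on generalizing x with
  | _ n ih =>
  set M := (Submodule.span k (Set.range (basisElt q K₂ K₁))).map (evalGen q K₁ K₂)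
  set E : Hecke q r := evalGen q K₁ K₂ (basisElt q K₂ K₁ x)
  have hE : E ∈ M := Submodule.mem_map_of_mem (Submodule.subset_span ⟨x, rfl⟩)
  have hleft : LeftConst K₂ E := leftConst_evalGen _
  have hright : RightConst K₁ E := rightConst_evalGen _
  have hrest : E - coef x.elt E • dsum q K₂ K₁ x.elt ∈ M := by
    refine mem_of_forall_dsum_mem (hleft.sub ((leftConst_dsum _ _ _).smul _))
      (hright.sub ((rightConst_dsum _ _ _).smul _)) fun d hd => ?_
    rw [map_sub, map_smul, coef_dsum, smul_eq_mul] at hd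
    have hdx : d ∉ dcoset K₂ K₁ x.elt := fun hdx =>
      hd (by rw [if_pos hdx, mul_one, coef_eq_of_mem_dcoset hleft hright hdx, sub_self])
    rw [if_neg hdx, mul_zero, sub_zero] at hd
    obtain ⟨σ, hlt, hσ⟩ := (mem_of_coef_evalGen_basisElt_ne_zero x hd).resolve_left hdx
    obtain ⟨y, hy⟩ := exists_label (K₂ := K₂) (K₁ := K₁) d
    have hyσ : perm σ ∈ dcoset K₂ K₁ (perm y.1.1) := by
      rw [← y.elt_right, ← dcoset_eq (perm_right_mem_dcoset hy)]
      exact mem_dcoset_symm hσ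
    rw [dsum_congr (dcoset_eq hy)]
    exact ih _ (hn ▸ (y.2.1 _ hyσ).trans_lt hlt) y rfl
  obtain ⟨a, ha⟩ := exists_coef_evalGen_basisElt_eq (q := q) x
  refine (M.smul_mem_iff (pow_ne_zero a hq)).1 ?_
  rw [← ha]
  exact (M.sub_mem_iff_right hE).1 hrest

theorem span_basisElt (hq : q ≠ 0) (K₂ K₁ : Finset (Fin r)) :
    Submodule.span k (Set.range (basisElt q K₂ K₁)) = ⊤ := by
  refine eq_top_iff.2 fun f _ => ?_
  have hf : evalGen q K₁ K₂ f ∈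
      (Submodule.span k (Set.range (basisElt q K₂ K₁))).map (evalGen q K₁ K₂) := by
    refine mem_of_forall_dsum_mem (leftConst_evalGen f) (rightConst_evalGen f) fun d _ => ?_
    obtain ⟨y, hy⟩ := exists_label (K₂ := K₂) (K₁ := K₁) d
    rw [dsum_congr (dcoset_eq hy)]
    exact y.dsum_elt_mem hq
  exact (evalGen_injective K₁ K₂).mem_set_image.1 hf

end HomBasis

section Schur

variable {k : Type*} [Field k] {q : k} {r : ℕ}

/-- The matrix entries of an element of the affine Schur algebra. -/
noncomputable def entries (q : k) (r : ℕ) :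
    Schur q r →ₗ[k] (∀ P : Finset (Fin r) × Finset (Fin r), HomH q P.1 P.2) where
  toFun φ P := DirectSum.component (Hecke q r)ᵐᵒᵖ (Finset (Fin r)) (fun L => ideal q L) P.2 ∘ₗ φ ∘ₗ
    DirectSum.lof (Hecke q r)ᵐᵒᵖ (Finset (Fin r)) (fun L => ideal q L) P.1
  map_add' _ _ := rfl
  map_smul' _ _ := rfl

theorem entries_injective : Function.Injective (entries q r) := fun _ _ h =>
  DirectSum.linearMap_ext _ fun J => LinearMap.ext fun x => DFinsupp.ext fun K =>
    LinearMap.congr_fun (congrFun h (J, K)) x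

theorem entries_toSchur (P : Finset (Fin r) × Finset (Fin r)) (f : HomH q P.1 P.2) :
    entries q r (toSchur q f) = Pi.single P f := by
  obtain ⟨J, K⟩ := P
  ext ⟨J', K'⟩ x : 2
  change DirectSum.component (Hecke q r)ᵐᵒᵖ _ (fun L => ideal q L) K'
    (DirectSum.lof (Hecke q r)ᵐᵒᵖ _ (fun L => ideal q L) K
      (f (DirectSum.component (Hecke q r)ᵐᵒᵖ _ (fun L => ideal q L) J
        (DirectSum.lof (Hecke q r)ᵐᵒᵖ _ (fun L => ideal q L) J' x)))) = _
  by_cases hP : (J', K') = (J, K)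
  · obtain ⟨rfl, rfl⟩ := Prod.mk.inj hP
    rw [Pi.single_eq_same, DirectSum.component.lof_self, DirectSum.component.lof_self]
  · rw [Pi.single_eq_of_ne hP, LinearMap.zero_apply, DirectSum.component.of]
    split_ifs with hK
    · subst hK
      have hJ : J' ≠ J := by
        rintro rfl
        exact hP rfl
      rw [DirectSum.component.of, dif_neg hJ, map_zero]
    · rfl

variable [NeZero r]

/-- The basis of the matrix entries which consists of the elements `basisElt` in one entry and zero
in the others. -/
noncomputable def entriesBasis (hq : q ≠ 0) :
    Module.Basis (Σ P : Finset (Fin r) × Finset (Fin r), Label P.2 P.1) k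
      (∀ P : Finset (Fin r) × Finset (Fin r), HomH q P.1 P.2) :=
  Pi.basis fun P => Module.Basis.mk (linearIndependent_basisElt hq P.2 P.1)
    (span_basisElt hq P.2 P.1).ge

theorem coe_entriesBasis (hq : q ≠ 0) : ⇑(entriesBasis hq) = entries q r ∘
    fun x : Σ P : Finset (Fin r) × Finset (Fin r), Label P.2 P.1 =>
      toSchur q (basisElt q x.1.2 x.1.1 x.2) := by
  funext x
  rw [Function.comp_apply, entries_toSchur, entriesBasis, Pi.basis_apply, Module.Basis.mk_apply]

theorem linearIndependent_toSchur_basisElt (hq : q ≠ 0) : LinearIndependent k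
    fun x : Σ P : Finset (Fin r) × Finset (Fin r), Label P.2 P.1 =>
      toSchur q (basisElt q x.1.2 x.1.1 x.2) := by
  refine LinearIndependent.of_comp (entries q r) ?_
  rw [← coe_entriesBasis hq]
  exact (entriesBasis hq).linearIndependent

theorem span_toSchur_basisElt (hq : q ≠ 0) : Submodule.span k (Set.range
    fun x : Σ P : Finset (Fin r) × Finset (Fin r), Label P.2 P.1 =>
      toSchur q (basisElt q x.1.2 x.1.1 x.2)) = ⊤ := by
  refine eq_top_iff.2 fun φ _ => entries_injective.mem_set_image.1 ?_
  rw [← Submodule.map_coe, Submodule.map_span, ← Set.range_comp, ← coe_entriesBasis hq,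
    (entriesBasis hq).span_eq]
  exact Submodule.mem_top

end Schur

end AffSchur

theorem mainTheorem7 {k : Type*} [Field k] (q : k) (hq : q ≠ 0) (r : ℕ) (hr : 1 ≤ r) :
    (∀ (K J : Finset (Fin r)) (d : AffSchur.W r),
      (AffSchur.b q K J d (AffSchur.gen q J) : AffSchur.Hecke q r) = AffSchur.dsum q K J d) ∧
    (∀ K₁ K₂ : Finset (Fin r),
      LinearIndependent k (AffSchur.basisElt q K₂ K₁) ∧
      Submodule.span k (Set.range (AffSchur.basisElt q K₂ K₁)) = ⊤) ∧
    (LinearIndependent k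
      (fun x : (Σ K : Finset (Fin r) × Finset (Fin r), AffSchur.Label K.2 K.1) =>
        AffSchur.toSchur q (AffSchur.basisElt q x.1.2 x.1.1 x.2)) ∧
     Submodule.span k (Set.range
      (fun x : (Σ K : Finset (Fin r) × Finset (Fin r), AffSchur.Label K.2 K.1) =>
        AffSchur.toSchur q (AffSchur.basisElt q x.1.2 x.1.1 x.2))) = ⊤) := by
  have : NeZero r := ⟨by omega⟩
  exact ⟨AffSchur.b_gen, fun K₁ K₂ =>
    ⟨AffSchur.linearIndependent_basisElt hq K₂ K₁, AffSchur.span_basisElt hq K₂ K₁⟩,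
    AffSchur.linearIndependent_toSchur_basisElt hq, AffSchur.span_toSchur_basisElt hq⟩
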